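/- Let $\mathcal S=[0,1]^d$ and $\mathcal T\subseteq\mathbb R$, with Borel probability measures $\mu_S$ on $\mathcal S$ and $\mu_T$ on $\mathcal T$. Let $k_S:\mathcal S^2\to[-1,1]$ and $k_T:\mathcal T^2\to[-1,1]$ be (measurable) stationary correlation functions, i.e. positive semidefinite kernels with $k_S(x,x)=k_T(t,t)=1$ that depend only on the difference of their two arguments, and let $k((x,t),(x',t'))=k_S(x,x')\,k_T(t,t')$. Let $\bar\lambda^S_1\ge\bar\lambda^S_2\ge\dots\ge0$ be the eigenvalues, counted with multiplicity and continued by $0$ if only finitely many are positive, of the covariance operator $(\Sigma_{k_S}f)(x)=\int k_S(x,u)f(u)\,d\mu_S(u)$ on $L^2(\mathcal S,\mu_S)$, and define $\bar\lambda^T_1\ge\bar\lambda^T_2\ge\dots\ge 0$ in the same way from $\Sigma_{k_T}$ on $L^2(\mathcal T,\mu_T)$. Then there are index sequences $(i_l)_{l\ge1}$, $(j_l)_{l\ge1}$ that list the products $\bar\lambda^S_i\bar\lambda^T_j$ in descending order: the pairs $(i_l,j_l)$ are pairwise distinct, $\bar\lambda^S_{i_l}\bar\lambda^T_{j_l}$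 is non-increasing in $l$, and no product $\bar\lambda^S_i\bar\lambda^T_j$ with $(i,j)$ not listed exceeds a listed one. Fix any such sequences. For observation points $(x_a,t_a)_{a\le n}$ (which may depend on $n$) put $K^{(n)}=(k((x_a,t_a),(x_b,t_b)))_{a,b\le n}$, $K_S^{(n)}=(k_S(x_a,x_b))_{a,b\le n}$ and $K_T^{(n)}=(k_T(t_a,t_b))_{a,b\le n}$, and let $\lambda_l(\cdot)$ denote the $l$-th largest eigenvalue, counted with multiplicity. Consider the following property of the observation points: for every $l\ge1$, $$\lim_{n\to\infty}\frac1n\lambda_l(K^{(n)})=\lim_{n\to\infty}\frac1n\Big[\frac1n\lambda_{i_l}(K_S^{(n)})\,\lambda_{j_l}(K_T^{(n)})\Big]=\bar\lambda^S_{i_l}\bar\lambda^T_{j_l},$$ so that $$\frac1n\Big[\lambda_l(K^{(n)})-\frac1n\lambda_{i_l}(K_S^{(n)})\,\lambda_{j_l}(K_T^{(n)})\Big]\to0,$$ and, if $\bar\lambda^S_{i_l}\bar\lambda^T_{j_l}>0$, $$\lambda_l(K^{(n)})\sim\frac1n\lambda_{i_l}(K_S^{(n)})\,\lambda_{j_l}(K_T^{(n)})\qquad(n\to\infty).$$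 (a) If $(x_1,t_1),(x_2,t_2),\dots$ are drawn independently from $\mu_S\otimes\mu_T$, and for each $n$ the first $n$ of them are used, the property holds almost surely. (b) Suppose that $k_S$ and $k_T$ are continuous, and that the (arbitrary, for instance deterministic) observation points satisfy $\frac1n\sum_{a\le n}f(x_a,t_a)\to\int f\,d(\mu_S\otimes\mu_T)$ for every bounded continuous $f:\mathcal S\times\mathcal T\to\mathbb R$ that takes equal values at $(x,t)$ and $(x',t')$ whenever $k_S(x,\cdot)=k_S(x',\cdot)$ and $k_T(t,\cdot)=k_T(t',\cdot)$. Then the property holds. -/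

import Mathlib

open MeasureTheory ProbabilityTheory Filter Topology Asymptotics

/-- The spatial domain `[0, 1]^d`. -/
abbrev SpatialDomain (d : ℕ) : Type := Fin d → unitInterval

/-- A (measurable) correlation function: a positive semidefinite kernel, i.e. one all of whose
finite kernel matrices are symmetric and positive semidefinite, normalised by `k x x = 1`. -/
structure IsCorrelation {X : Type*} [MeasurableSpace X] (k : X → X → ℝ) : Prop where
  measurable : Measurable (Function.uncurry k)
  posSemidef : ∀ (n : ℕ) (x : Fin n → X), (Matrix.of fun a b => k (x a) (x b)).PosSemidef
  diag : ∀ x, k x x = 1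

/-- Stationarity: `k x y` depends only on the difference of the coordinates of `x` and `y`. -/
def IsStationaryKernel {X V : Type*} [Sub V] (coord : X → V) (k : X → X → ℝ) : Prop :=
  ∃ κ : V → ℝ, ∀ x y, k x y = κ (coord x - coord y)

/-- The separable kernel `((x, t), (x', t')) ↦ kS x x' * kT t t'`. -/
def separableKernel {S T : Type*} (kS : S → S → ℝ) (kT : T → T → ℝ) : S × T → S × T → ℝ :=
  fun p q => kS p.1 q.1 * kT p.2 q.2

theorem IsCorrelation.abs_le_one {X : Type*} [MeasurableSpace X] {k : X → X → ℝ}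
    (hk : IsCorrelation k) (x y : X) : |k x y| ≤ 1 := by
  have h := (hk.posSemidef 2 ![x, y])
  have hdet := h.det_nonneg
  have hs := h.1.apply 0 1
  simp [Matrix.det_fin_two, hk.diag] at hdet hs
  rw [abs_le_one_iff_mul_self_le_one]
  rw [hs] at hdet
  exact hdet

theorem IsCorrelation.integrable_mul {X : Type*} [MeasurableSpace X] {k : X → X → ℝ}
    (hk : IsCorrelation k) (μ : Measure X) [IsProbabilityMeasure μ] (f : Lp ℝ 2 μ) (x : X) :
    Integrable (fun u => k x u * f u) μ := by
  have hf : Integrable (f : X → ℝ) μ := (Lp.memLp f).integrable (by norm_num)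
  refine hf.bdd_mul (c := 1) ?_ (ae_of_all _ fun u => ?_)
  · exact (hk.measurable.comp measurable_prodMk_left).aestronglyMeasurable
  · simpa using hk.abs_le_one x u

theorem IsCorrelation.memLp_integral {X : Type*} [MeasurableSpace X] {k : X → X → ℝ}
    (hk : IsCorrelation k) (μ : Measure X) [IsProbabilityMeasure μ] (f : Lp ℝ 2 μ) :
    MemLp (fun x => ∫ u, k x u * f u ∂μ) 2 μ := by
  have hf : Integrable (f : X → ℝ) μ := (Lp.memLp f).integrable (by norm_num)
  refine MemLp.of_bound (C := ∫ u, ‖f u‖ ∂μ) ?_ (ae_of_all _ fun x => ?_)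
  · have hm : StronglyMeasurable (Function.uncurry fun x u => k x u * f u) :=
      (hk.measurable.stronglyMeasurable).mul
        ((Lp.stronglyMeasurable f).comp_measurable measurable_snd)
    exact hm.integral_prod_right.aestronglyMeasurable
  · refine norm_integral_le_of_norm_le hf.norm (ae_of_all _ fun u => ?_)
    rw [norm_mul]
    exact mul_le_of_le_one_left (norm_nonneg _) (by simpa using hk.abs_le_one x u)

/-- The covariance operator on `L²(X, μ)`: `(Σ f)(x) = ∫ k x u * f u dμ(u)`. -/
noncomputable def covOperator {X : Type*} [MeasurableSpace X] {k : X → X → ℝ}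
    (hk : IsCorrelation k) (μ : Measure X) [IsProbabilityMeasure μ] :
    Module.End ℝ (Lp ℝ 2 μ) where
  toFun f := (hk.memLp_integral μ f).toLp _
  map_add' f g := by
    rw [← MemLp.toLp_add]
    refine MemLp.toLp_congr _ _ (ae_of_all _ fun x => ?_)
    simp only [Pi.add_apply]
    rw [← integral_add (hk.integrable_mul μ f x) (hk.integrable_mul μ g x)]
    refine integral_congr_ae ?_
    filter_upwards [Lp.coeFn_add f g] with u hu
    rw [hu, Pi.add_apply, mul_add]
  map_smul' c f := by
    rw [RingHom.id_apply, ← MemLp.toLp_const_smul]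
    refine MemLp.toLp_congr _ _ (ae_of_all _ fun x => ?_)
    simp only [Pi.smul_apply, smul_eq_mul]
    rw [← integral_const_mul]
    refine integral_congr_ae ?_
    filter_upwards [Lp.coeFn_smul c f] with u hu
    rw [hu, Pi.smul_apply, smul_eq_mul]
    ring

/-- The `i`-th largest eigenvalue (`i = 0` is the largest), counted with multiplicity, of a compact
positive operator, continued by `0` if there are at most `i` positive ones: the largest `c > 0` such
that the eigenspaces of the eigenvalues `≥ c` have total dimension at least `i + 1`. -/
noncomputable def opEigenvalue {V : Type*} [AddCommGroup V] [Module ℝ V] (A : Module.End ℝ V)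
    (i : ℕ) : ℝ :=
  sSup {c : ℝ | 0 < c ∧
    ((i + 1 : ℕ) : Cardinal) ≤ Module.rank ℝ ↥(⨆ c' : Set.Ici c, A.eigenspace (c' : ℝ))}

/-- The `i`-th largest eigenvalue (`i = 0` is the largest), counted with multiplicity, of a
symmetric `n × n` matrix, for `i < n`. -/
noncomputable def matEigenvalue {n : ℕ} (A : Matrix (Fin n) (Fin n) ℝ) (i : ℕ) : ℝ :=
  open Classical in
  if h : A.IsHermitian ∧ i < n then
    h.1.eigenvalues₀ ⟨i, (Fintype.card_fin n).symm ▸ h.2⟩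
  else 0

/-- The kernel matrix `(k (x a) (x b))_{a, b}` of a family of `n` points. -/
def kernelMatrix {X : Type*} (k : X → X → ℝ) {n : ℕ} (x : Fin n → X) :
    Matrix (Fin n) (Fin n) ℝ :=
  Matrix.of fun a b => k (x a) (x b)

/-- The datasets `z n` of `n` points have the limit distribution `ν`, as far as the kernels see it:
the averages over the points of `z n` of a bounded continuous function tend to its `ν`-integral, for
all those functions that take equal values at any two points which `kS` and `kT` do not tell apart
(all bounded continuous functions, if the kernels separate points). -/
def HasLimitDistribution {S T : Type*} [TopologicalSpace S] [TopologicalSpace T]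
    [MeasurableSpace S] [MeasurableSpace T] (kS : S → S → ℝ) (kT : T → T → ℝ)
    (z : ∀ n, Fin n → S × T) (ν : Measure (S × T)) : Prop :=
  ∀ f : BoundedContinuousFunction (S × T) ℝ,
    (∀ x x' t t', (∀ y, kS x y = kS x' y) → (∀ s, kT t s = kT t' s) → f (x, t) = f (x', t')) →
    Tendsto (fun n : ℕ => (1 / n : ℝ) * ∑ a : Fin n, f (z n a)) atTop (𝓝 (∫ p, f p ∂ν))

/-- The index sequences `(i_l)`, `(j_l)` list the products `a i * b j` in descending order: distinct
`l` use distinct index pairs, the listed products are non-increasing in `l`, and no product that is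
left out exceeds a listed one. -/
structure IsDescendingOrdering (a b : ℕ → ℝ) (i j : ℕ → ℕ) : Prop where
  injective : Function.Injective fun l => (i l, j l)
  antitone : Antitone fun l => a (i l) * b (j l)
  le_of_notMem : ∀ p q : ℕ, (p, q) ∉ Set.range (fun l => (i l, j l)) →
    ∀ l, a p * b q ≤ a (i l) * b (j l)

/-- The asymptotic equality of `λ_l(K)` and `(1/n) λ_{i_l}(K_S) λ_{j_l}(K_T)` as `n → ∞`, for the
datasets `z n` of `n` points: after division by `n` (the scale on which the eigenvalues of kernel
matrices converge) both sides have the same limit `lamS (i l) * lamT (j l)`, so that their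
difference vanishes; and where this limit is positive, the two sides are asymptotically equivalent
(their ratio tends to `1`). -/
def SpectrumFactorizes {S T : Type*} (kS : S → S → ℝ) (kT : T → T → ℝ) (z : ∀ n, Fin n → S × T)
    (lamS lamT : ℕ → ℝ) (i j : ℕ → ℕ) : Prop :=
  ∀ l : ℕ,
    let lhs : ℕ → ℝ := fun n => matEigenvalue (kernelMatrix (separableKernel kS kT) (z n)) l
    let rhs : ℕ → ℝ := fun n => (1 / n : ℝ) *
      matEigenvalue (kernelMatrix kS fun a => (z n a).1) (i l) *
      matEigenvalue (kernelMatrix kT fun a => (z n a).2) (j l)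
    Tendsto (fun n : ℕ => (1 / n : ℝ) * lhs n) atTop (𝓝 (lamS (i l) * lamT (j l))) ∧
    Tendsto (fun n : ℕ => (1 / n : ℝ) * rhs n) atTop (𝓝 (lamS (i l) * lamT (j l))) ∧
    Tendsto (fun n : ℕ => (1 / n : ℝ) * (lhs n - rhs n)) atTop (𝓝 0) ∧
    (0 < lamS (i l) * lamT (j l) → lhs ~[atTop] rhs)

/-! ### Listing a null family in descending order -/

/-! The proof is by the method of moments. After division by `n`, the eigenvalues of a correlation
matrix form a nonnegative, non-increasing sequence with sum `1`, so the `i`-th entry (from `0`) is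
at most `1 / (i + 1)`. Such sequences lie in a compact product of intervals, and their power sums of
order at least `2` are continuous there by domination. A non-increasing nonnegative null sequence is
determined by its even power sums of large order. Hence convergence of these power sums forces
convergence of each eigenvalue (`tendsto_of_evenPowerSums_tendsto`).

The power sum of order `p` of the eigenvalues of `K / n` is `n ^ (-p) * tr (K ^ p)`, an average of
products of the kernel along closed walks through the observation points, that is, a V-statistic.
Its limit should be the integral of the closed walk weight over independent points, which is the
trace of the `p`-th iterated kernel. For even `p ≥ 4` this trace is the power sum of the operator
eigenvalues (`hasSum_pow_kernelTrace`), by Parseval at every point and without continuity of the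
kernel.

For the separable kernel the traces multiply (`kernelTrace_separableKernel`), and a product of two
power sums is the power sum of all products of eigenvalues. So the listed products have the right
moments, and the same criterion (`tendsto_matEigenvalue`) treats `kS`, `kT` and their product, all
regarded as kernels on `S × T`.

It remains to prove convergence of the V-statistics. For independent points a second moment bound of
order `1 / n` is summable along squares, and boundedness fills the gaps (`ae_tendsto_vStatistic`).
For continuous kernels the empirical measures converge weakly in the pseudometrics induced by the
kernels, and so do their powers (`tendsto_vStatistic_of_tendsto`). -/

theorem exists_notMem_forall_le {ι : Type*} [Infinite ι] {c : ι → ℝ}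
    (h0 : ∀ p, 0 ≤ c p) (hc : Tendsto c cofinite (𝓝 0)) (F : Finset ι) :
    ∃ p ∉ F, ∀ p' ∉ F, c p' ≤ c p := by
  by_cases h : ∃ p₀ ∉ F, 0 < c p₀
  · obtain ⟨p₀, hp₀, hpos⟩ := h
    have hfin : {p | c p₀ ≤ c p}.Finite := by
      have := hc.eventually (gt_mem_nhds hpos)
      rw [eventually_cofinite] at this
      simpa using this
    have hfin' : ({p | c p₀ ≤ c p} \ (F : Set ι)).Finite := hfin.sdiff
    obtain ⟨p, hp, hmax⟩ := Set.exists_max_image _ c hfin' ⟨p₀, by simp, hp₀⟩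
    refine ⟨p, hp.2, fun p' hp' => ?_⟩
    by_cases h' : c p₀ ≤ c p'
    · exact hmax p' ⟨by simpa using h', hp'⟩
    · exact (not_le.mp h').le.trans (by simpa using hp.1)
  · push Not at h
    obtain ⟨p, hp⟩ := Infinite.exists_notMem_finset F
    exact ⟨p, hp, fun p' hp' => (h p' hp').trans (h0 p)⟩

/-- Greedy choice: each step takes a maximiser outside the finite set `F n` already used. One exists
because only finitely many values exceed a given positive number. -/
theorem exists_descending_listing {ι : Type*} [Infinite ι] {c : ι → ℝ}
    (h0 : ∀ p, 0 ≤ c p) (hc : Tendsto c cofinite (𝓝 0)) :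
    ∃ s : ℕ → ι, Function.Injective s ∧ Antitone (c ∘ s) ∧
      ∀ p ∉ Set.range s, ∀ l, c p ≤ c (s l) := by
  classical
  choose g hg hmax using exists_notMem_forall_le h0 hc
  let F : ℕ → Finset ι := fun n => Nat.rec ∅ (fun _ F => insert (g F) F) n
  have hF : ∀ n, F (n + 1) = insert (g (F n)) (F n) := fun n => rfl
  have hmono : Monotone F := monotone_nat_of_le_succ fun n => by
    rw [hF]; exact Finset.subset_insert _ _
  have hmem : ∀ {m n}, m < n → g (F m) ∈ F n := fun {m n} h =>
    hmono (Nat.succ_le_of_lt h) (by rw [hF]; exact Finset.mem_insert_self _ _)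
  have hrange : ∀ n, ∀ p ∈ F n, p ∈ Set.range fun m => g (F m) := by
    intro n
    induction n with
    | zero => intro p hp; exact absurd hp (Finset.notMem_empty p)
    | succ n ih =>
      intro p hp
      rw [hF, Finset.mem_insert] at hp
      rcases hp with rfl | hp
      · exact ⟨n, rfl⟩
      · exact ih p hp
  refine ⟨fun n => g (F n), ?_, ?_, ?_⟩
  · intro m n (hmn : g (F m) = g (F n))
    by_contra hne
    rcases lt_or_gt_of_ne hne with h | h
    · exact hg (F n) (hmn ▸ hmem h :)
    · exact hg (F m) (hmn.symm ▸ hmem h :)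
  · intro m n hmn
    exact hmax (F m) _ fun h => hg (F n) (hmono hmn h)
  · intro p hp l
    exact hmax (F l) p fun h => hp (hrange l p h)

/-- An unlisted value lies below all listed ones, and these tend to `0` because the listing is
injective. -/
theorem eq_zero_of_notMem_listing {ι : Type*} {c : ι → ℝ} (h0 : ∀ p, 0 ≤ c p)
    (hc : Tendsto c cofinite (𝓝 0)) {s : ℕ → ι} (hs : Function.Injective s)
    (hle : ∀ p ∉ Set.range s, ∀ l, c p ≤ c (s l)) {p : ι} (hp : p ∉ Set.range s) : c p = 0 := by
  have h : Tendsto (c ∘ s) atTop (𝓝 0) := by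
    rw [← Nat.cofinite_eq_atTop]
    exact hc.comp hs.tendsto_cofinite
  exact le_antisymm (ge_of_tendsto' h (hle p hp)) (h0 p)

theorem tendsto_cofinite_zero_of_summable_pow {ι : Type*} {c : ι → ℝ} (h0 : ∀ p, 0 ≤ c p) {m : ℕ}
    (hm : m ≠ 0) (h : Summable fun p => c p ^ m) : Tendsto c cofinite (𝓝 0) := by
  have h1 := h.tendsto_cofinite_zero
  have h2 := h1.rpow_const (p := (m : ℝ)⁻¹) (Or.inr (by positivity))
  rw [Real.zero_rpow (by positivity)] at h2
  refine h2.congr fun p => ?_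
  exact Real.pow_rpow_inv_natCast (h0 p) hm

/-! ### Antitone sequences are determined by their power sums -/

theorem Summable.pow_of_le {ι : Type*} {c : ι → ℝ} (h0 : ∀ p, 0 ≤ c p) {C : ℝ}
    (hC : ∀ p, c p ≤ C) {m m' : ℕ} (hm : m ≤ m') (h : Summable fun p => c p ^ m) :
    Summable fun p => c p ^ m' := by
  refine Summable.of_nonneg_of_le (fun p => pow_nonneg (h0 p) _) (fun p => ?_)
    (h.mul_left (C ^ (m' - m)))
  obtain ⟨r, rfl⟩ := Nat.exists_eq_add_of_le hm
  rw [pow_add, Nat.add_sub_cancel_left, mul_comm]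
  exact mul_le_mul_of_nonneg_right (pow_le_pow_left₀ (h0 p) (hC p) _) (pow_nonneg (h0 p) _)

/-- Cancel the common entries before `i`. If `b i < a i`, then `a i ^ (2q+4)` is at most the tail
power sum of `b`, hence at most `C * b i ^ (2q)`; this fails for large `q` because the ratio `b i /
a i` is below `1`. -/
theorem le_of_evenPowerSums_eq {a b : ℕ → ℝ} (ha0 : ∀ i, 0 ≤ a i)
    (hb0 : ∀ i, 0 ≤ b i) (ha : Antitone a) (hb : Antitone b) (has : Summable fun i => a i ^ 4)
    (hbs : Summable fun i => b i ^ 4)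
    (h : ∀ q : ℕ, ∑' i, a i ^ (2 * q + 4) = ∑' i, b i ^ (2 * q + 4)) (i : ℕ)
    (hi : ∀ j < i, a j = b j) : a i ≤ b i := by
  by_contra hlt
  push Not at hlt
  have hapos : 0 < a i := (hb0 i).trans_lt hlt
  have has' : ∀ q, Summable fun i => a i ^ (2 * q + 4) := fun q =>
    has.pow_of_le ha0 (fun p => ha (Nat.zero_le p)) (by omega)
  have hbs' : ∀ q, Summable fun i => b i ^ (2 * q + 4) := fun q =>
    hbs.pow_of_le hb0 (fun p => hb (Nat.zero_le p)) (by omega)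
  have htail : ∀ q : ℕ, ∑' j, a (j + i) ^ (2 * q + 4) = ∑' j, b (j + i) ^ (2 * q + 4) := by
    intro q
    have h1 := (has' q).sum_add_tsum_nat_add i
    have h2 := (hbs' q).sum_add_tsum_nat_add i
    have h3 : ∑ j ∈ Finset.range i, a j ^ (2 * q + 4) = ∑ j ∈ Finset.range i, b j ^ (2 * q + 4) :=
      Finset.sum_congr rfl fun j hj => by rw [hi j (Finset.mem_range.mp hj)]
    linarith [h q]
  set C := ∑' j, b (j + i) ^ 4
  have hbound : ∀ q : ℕ, a i ^ 4 ≤ C * ((b i / a i) ^ 2) ^ q := by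
    intro q
    have h1 : a i ^ (2 * q + 4) ≤ ∑' j, a (j + i) ^ (2 * q + 4) := by
      have := ((summable_nat_add_iff i).mpr (has' q)).le_tsum 0
        fun j _ => pow_nonneg (ha0 (j + i)) _
      simpa using this
    have h2 : ∑' j, b (j + i) ^ (2 * q + 4) ≤ ∑' j, b i ^ (2 * q) * b (j + i) ^ 4 := by
      refine ((summable_nat_add_iff i).mpr (hbs' q)).tsum_le_tsum (fun j => ?_)
        (((summable_nat_add_iff i).mpr hbs).mul_left _)
      rw [pow_add]
      exact mul_le_mul_of_nonneg_right
        (pow_le_pow_left₀ (hb0 _) (hb (Nat.le_add_left i j)) _) (pow_nonneg (hb0 _) _)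
    rw [tsum_mul_left] at h2
    have h3 := (h1.trans_eq (htail q)).trans h2
    rw [← pow_mul, div_pow, ← mul_div_assoc, le_div_iff₀ (pow_pos hapos _), ← pow_add]
    calc a i ^ (4 + 2 * q) = a i ^ (2 * q + 4) := by ring_nf
      _ ≤ _ := h3
      _ = _ := mul_comm _ _
  have hlim : Tendsto (fun q : ℕ => C * ((b i / a i) ^ 2) ^ q) atTop (𝓝 (C * 0)) := by
    refine Tendsto.const_mul C (tendsto_pow_atTop_nhds_zero_of_lt_one (sq_nonneg _) ?_)
    exact pow_lt_one₀ (div_nonneg (hb0 i) hapos.le) ((div_lt_one hapos).mpr hlt) two_ne_zero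
  rw [mul_zero] at hlim
  exact absurd (ge_of_tendsto' hlim hbound) (not_le.mpr (pow_pos hapos 4))

theorem eq_of_evenPowerSums_eq {a b : ℕ → ℝ} (ha0 : ∀ i, 0 ≤ a i)
    (hb0 : ∀ i, 0 ≤ b i) (ha : Antitone a) (hb : Antitone b) (has : Summable fun i => a i ^ 4)
    (hbs : Summable fun i => b i ^ 4)
    (h : ∀ q : ℕ, ∑' i, a i ^ (2 * q + 4) = ∑' i, b i ^ (2 * q + 4)) : a = b := by
  funext i
  induction i using Nat.strong_induction_on with
  | _ i ih =>
    exact le_antisymm (le_of_evenPowerSums_eq ha0 hb0 ha hb has hbs h i ih)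
      (le_of_evenPowerSums_eq hb0 ha0 hb ha hbs has (fun q => (h q).symm) i
        fun j hj => (ih j hj).symm)

theorem summable_inv_succ_pow {m : ℕ} (hm : 2 ≤ m) :
    Summable fun i : ℕ => ((1 : ℝ) / (i + 1)) ^ m := by
  have := (summable_nat_add_iff 1).mpr (Real.summable_one_div_nat_pow.mpr (by omega : 1 < m))
  refine this.congr fun i => ?_
  push_cast
  rw [div_pow, one_pow]

/-- Convergence of the even power sums of antitone sequences implies convergence of the entries. -/
theorem tendsto_of_evenPowerSums_tendsto {κ : Type*} {f : Filter κ} {a : κ → ℕ → ℝ} {lam : ℕ → ℝ}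
    (ha0 : ∀ᶠ n in f, ∀ i, 0 ≤ a n i) (ha1 : ∀ᶠ n in f, ∀ i, a n i ≤ 1 / (i + 1))
    (ha : ∀ᶠ n in f, Antitone (a n)) (hl0 : ∀ i, 0 ≤ lam i) (hl : Antitone lam)
    (hls : Summable fun i => lam i ^ 4)
    (h : ∀ q : ℕ, Tendsto (fun n => ∑' i, a n i ^ (2 * q + 4)) f (𝓝 (∑' i, lam i ^ (2 * q + 4))))
    (i : ℕ) : Tendsto (fun n => a n i) f (𝓝 (lam i)) := by
  -- Along an ultrafilter every entry converges by compactness, so no subsequence has to be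
  -- extracted. The limit sequence `b` has the power sums of `lam`, hence equals it.
  rw [tendsto_iff_ultrafilter]
  intro U hU
  have hlim : ∀ j, ∃ x : ℝ, Tendsto (fun n => a n j) U (𝓝 x) := by
    intro j
    have hK : IsCompact (Set.Icc (0 : ℝ) (1 / (j + 1))) := isCompact_Icc
    obtain ⟨x, -, hx⟩ := hK.ultrafilter_le_nhds (U.map fun n => a n j) (by
      rw [le_principal_iff]
      change ∀ᶠ n in (U : Filter κ), a n j ∈ Set.Icc (0 : ℝ) (1 / (j + 1))
      filter_upwards [hU ha0, hU ha1] with n h0 h1 using ⟨h0 j, h1 j⟩)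
    exact ⟨x, hx⟩
  choose b hb using hlim
  have hb0 : ∀ j, 0 ≤ b j := fun j => ge_of_tendsto (hb j) (by
    filter_upwards [hU ha0] with n h0 using h0 j)
  have hb1 : ∀ j : ℕ, b j ≤ 1 / (j + 1) := fun j => le_of_tendsto (hb j) (by
    filter_upwards [hU ha1] with n h0 using h0 j)
  have hbanti : Antitone b := fun j k hjk => le_of_tendsto_of_tendsto (hb k) (hb j) (by
    filter_upwards [hU ha] with n h0 using h0 hjk)
  have hbs : Summable fun i => b i ^ 4 :=
    Summable.of_nonneg_of_le (fun j => pow_nonneg (hb0 j) _)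
      (fun j => pow_le_pow_left₀ (hb0 j) (hb1 j) _) (summable_inv_succ_pow (by norm_num))
  have heq : b = lam := by
    refine eq_of_evenPowerSums_eq hb0 hl0 hbanti hl hbs hls fun q => ?_
    refine tendsto_nhds_unique ?_ ((h q).mono_left hU)
    refine tendsto_tsum_of_dominated_convergence
      (summable_inv_succ_pow (by omega : 2 ≤ 2 * q + 4)) (fun j => (hb j).pow _) ?_
    filter_upwards [hU ha0, hU ha1] with n h0 h1 j
    rw [Real.norm_of_nonneg (pow_nonneg (h0 j) _)]
    exact pow_le_pow_left₀ (h0 j) (h1 j) _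
  exact heq ▸ hb i

/-! ### Hilbert bases of eigenvectors and `opEigenvalue` -/

/-- Hilbert bases of the pieces combine: a vector orthogonal to all of them is orthogonal to each `W
c`, since inner products may be taken termwise in the expansions, and so it vanishes. -/
theorem exists_hilbertBasis_of_orthogonalFamily {E κ : Type*} [NormedAddCommGroup E]
    [InnerProductSpace ℝ E] [CompleteSpace E] (W : κ → Submodule ℝ E)
    [∀ c, CompleteSpace (W c)] (hW : OrthogonalFamily ℝ (fun c => W c) fun c => (W c).subtypeₗᵢ)
    (hbot : (⨆ c, W c)ᗮ = ⊥) :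
    ∃ (w : ∀ c, Set (W c)) (b : HilbertBasis (Σ c, w c) ℝ E), ∀ p, b p ∈ W p.1 := by
  classical
  choose w b hb using fun c => exists_hilbertBasis ℝ (W c)
  have hv : Orthonormal ℝ fun p : Σ c, w c => (b p.1 p.2 : E) :=
    hW.orthonormal_sigma_orthonormal (v_family := fun c => (b c : w c → W c))
      fun c => (b c).orthonormal
  have hperp : (Submodule.span ℝ (Set.range fun p : Σ c, w c => (b p.1 p.2 : E)))ᗮ = ⊥ := by
    rw [Submodule.eq_bot_iff]
    intro x hx
    have hx' : ∀ c (i : w c), inner ℝ (b c i : E) x = 0 := fun c i =>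
      (Submodule.mem_orthogonal _ x).mp hx _ (Submodule.subset_span ⟨⟨c, i⟩, rfl⟩)
    rw [Submodule.eq_bot_iff] at hbot
    apply hbot
    rw [← Submodule.iInf_orthogonal, Submodule.mem_iInf]
    intro c
    rw [Submodule.mem_orthogonal]
    intro u hu
    have h1 := ((b c).hasSum_repr ⟨u, hu⟩).mapL ((innerSL ℝ x).comp (W c).subtypeL)
    have h2 : ∀ i, ((innerSL ℝ x).comp (W c).subtypeL) ((b c).repr ⟨u, hu⟩ i • b c i) = 0 := by
      intro i
      rw [map_smul]
      have : ((innerSL ℝ x).comp (W c).subtypeL) (b c i) = 0 := by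
        simpa [real_inner_comm] using hx' c i
      rw [this, smul_zero]
    simp only [h2] at h1
    have h3 := h1.unique hasSum_zero
    rw [real_inner_comm]
    simpa using h3
  refine ⟨w, HilbertBasis.mkOfOrthogonalEqBot hv hperp, fun p => ?_⟩
  rw [HilbertBasis.coe_mkOfOrthogonalEqBot]
  exact (b p.1 p.2).2

theorem exists_hilbertBasis_eigenvectors {E : Type*} [NormedAddCommGroup E]
    [InnerProductSpace ℝ E] [CompleteSpace E] {A : E →L[ℝ] E} (hA : IsCompactOperator A)
    (hsymm : (A : E →ₗ[ℝ] E).IsSymmetric) :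
    ∃ (w : ∀ c : ℝ, Set (Module.End.eigenspace (A : Module.End ℝ E) c))
      (b : HilbertBasis (Σ c, w c) ℝ E), ∀ p, A (b p) = p.1 • b p := by
  have hcomplete : ∀ c, CompleteSpace (Module.End.eigenspace (A : Module.End ℝ E) c) := by
    intro c
    have : ((Module.End.eigenspace (A : Module.End ℝ E) c : Submodule ℝ E) : Set E) =
        {v | A v = c • v} := by
      ext v
      exact Module.End.mem_eigenspace_iff
    have hclosed : IsClosed
        ((Module.End.eigenspace (A : Module.End ℝ E) c : Submodule ℝ E) : Set E) := by
      rw [this]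
      exact isClosed_eq A.continuous (continuous_const_smul c)
    exact hclosed.isComplete.completeSpace_coe
  obtain ⟨w, b, hb⟩ := exists_hilbertBasis_of_orthogonalFamily _
    hsymm.orthogonalFamily_eigenspaces
    (ContinuousLinearMap.orthogonalComplement_iSup_eigenspaces_eq_bot hA hsymm)
  exact ⟨w, b, fun p => Module.End.mem_eigenspace_iff.mp (hb p)⟩

section Sorted

variable {ι E : Type*} [NormedAddCommGroup E] [InnerProductSpace ℝ E]

/-- An eigenvector for `c' ≥ c` has nonzero coordinates only where `lam i = c'`. Since `lam` is a
null family there are finitely many such `i`, so the algebraic span suffices and no closure is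
needed. -/
theorem iSup_eigenspace_eq_span {A : Module.End ℝ E} (b : HilbertBasis ι ℝ E) {lam : ι → ℝ}
    (hA : ∀ i, A (b i) = lam i • b i) (hsymm : A.IsSymmetric)
    (hlam : Tendsto lam cofinite (𝓝 0)) {c : ℝ} (hc : 0 < c) :
    (⨆ c' : Set.Ici c, A.eigenspace (c' : ℝ)) =
      Submodule.span ℝ (Set.range fun i : {i | c ≤ lam i} => b i) := by
  apply le_antisymm
  · refine iSup_le fun c' v hv => ?_
    have hc' : c ≤ (c' : ℝ) := c'.2
    have hfin : {i | (c' : ℝ) ≤ lam i}.Finite := by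
      have := hlam.eventually (gt_mem_nhds (hc.trans_le hc'))
      rw [eventually_cofinite] at this
      simpa using this
    have hrepr : ∀ i, (c' : ℝ) ≠ lam i → b.repr v i = 0 := by
      intro i hi
      rw [Module.End.mem_eigenspace_iff] at hv
      have h1 := hsymm (b i) v
      rw [hA, hv, inner_smul_left, inner_smul_right] at h1
      rw [b.repr_apply_apply]
      have h2 : ((c' : ℝ) - lam i) * inner ℝ (b i) v = 0 := by
        rw [sub_mul, sub_eq_zero]; simpa using h1.symm
      exact (mul_eq_zero.mp h2).resolve_left (sub_ne_zero.mpr hi)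
    have h1 := b.hasSum_repr v
    have h2 : HasSum (fun i => b.repr v i • b i) (∑ i ∈ hfin.toFinset, b.repr v i • b i) := by
      refine hasSum_sum_of_ne_finset_zero fun i hi => ?_
      rw [hrepr i, zero_smul]
      intro h
      exact hi (by simp [h])
    rw [h1.unique h2]
    refine Submodule.sum_mem _ fun i hi => Submodule.smul_mem _ _ (Submodule.subset_span ?_)
    refine ⟨⟨i, ?_⟩, rfl⟩
    have : (c' : ℝ) ≤ lam i := by simpa using hi
    exact hc'.trans this
  · rw [Submodule.span_le]
    rintro _ ⟨⟨i, hi⟩, rfl⟩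
    have : b i ∈ A.eigenspace ((⟨lam i, hi⟩ : Set.Ici c) : ℝ) :=
      Module.End.mem_eigenspace_iff.mpr (hA i)
    exact Submodule.mem_iSup_of_mem (p := fun c' : Set.Ici c => A.eigenspace (c' : ℝ)) _ this

theorem rank_iSup_eigenspace {A : Module.End ℝ E} (b : HilbertBasis ι ℝ E) {lam : ι → ℝ}
    (hA : ∀ i, A (b i) = lam i • b i) (hsymm : A.IsSymmetric)
    (hlam : Tendsto lam cofinite (𝓝 0)) {c : ℝ} (hc : 0 < c) :
    Module.rank ℝ ↥(⨆ c' : Set.Ici c, A.eigenspace (c' : ℝ)) = ({i | c ≤ lam i}.ncard : ℕ) := by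
  have hfin : {i | c ≤ lam i}.Finite := by
    have := hlam.eventually (gt_mem_nhds hc)
    rw [eventually_cofinite] at this
    simpa using this
  have hli : LinearIndependent ℝ fun i : {i | c ≤ lam i} => b i :=
    b.orthonormal.linearIndependent.comp _ Subtype.val_injective
  have : Finite {i | c ≤ lam i} := hfin
  rw [iSup_eigenspace_eq_span b hA hsymm hlam hc, rank_span hli,
    ← Set.cast_ncard (Set.finite_range _)]
  congr 1
  rw [← Set.image_univ, Set.ncard_image_of_injective _ hli.injective, Set.ncard_univ,
    Nat.card_coe_set_eq]

/-- The sequence `opEigenvalue A` lists the eigenvalues belonging to a Hilbert basis of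
eigenvectors, padded by zeros, in descending order. -/
theorem opEigenvalue_eq_listing {A : Module.End ℝ E} (b : HilbertBasis ι ℝ E) {lam : ι → ℝ}
    (hA : ∀ i, A (b i) = lam i • b i) (hsymm : A.IsSymmetric) (hlam0 : ∀ i, 0 ≤ lam i)
    (hlam : Tendsto lam cofinite (𝓝 0)) {s : ℕ → ι ⊕ ℕ} (hs : Function.Injective s)
    (hanti : Antitone fun l => Sum.elim lam (0 : ℕ → ℝ) (s l))
    (hzero : ∀ p ∉ Set.range s, Sum.elim lam (0 : ℕ → ℝ) p = 0) (l : ℕ) :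
    opEigenvalue A l = Sum.elim lam (0 : ℕ → ℝ) (s l) := by
  set g : ι ⊕ ℕ → ℝ := Sum.elim lam (0 : ℕ → ℝ) with hg
  have hg0 : ∀ p, 0 ≤ g p := by rintro (i | i) <;> simp [hg, hlam0]
  -- The rank in the definition counts the `i` with `c ≤ lam i`. As the listing descends, this count
  -- is at least `l + 1` exactly when `c ≤ g (s l)`.
  have hset : {c : ℝ | 0 < c ∧
      ((l + 1 : ℕ) : Cardinal) ≤ Module.rank ℝ ↥(⨆ c' : Set.Ici c, A.eigenspace (c' : ℝ))} =
      Set.Ioc 0 (g (s l)) := by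
    ext c
    rw [Set.mem_ofPred_eq, Set.mem_Ioc]
    refine and_congr_right fun hc => ?_
    rw [rank_iSup_eigenspace b hA hsymm hlam hc, Nat.cast_le]
    have himage : Sum.inl '' {i | c ≤ lam i} = s '' {m | c ≤ g (s m)} := by
      ext p
      constructor
      · rintro ⟨i, hi, rfl⟩
        have hi' : c ≤ g (Sum.inl i) := by simpa [hg] using hi
        by_cases hp : Sum.inl i ∈ Set.range s
        · obtain ⟨m, hm⟩ := hp
          exact ⟨m, by simpa [hm] using hi', hm⟩
        · exact absurd (hi'.trans_eq (hzero _ hp)) (not_le.mpr hc)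
      · rintro ⟨m, hm, rfl⟩
        have hm' : c ≤ g (s m) := hm
        rcases hsm : s m with i | i
        · rw [hsm] at hm'
          exact ⟨i, by simpa [hg] using hm', rfl⟩
        · rw [hsm] at hm'
          exact absurd hm' (by simpa [hg] using hc)
    have hfin : {i | c ≤ lam i}.Finite := by
      have := hlam.eventually (gt_mem_nhds hc)
      rw [eventually_cofinite] at this
      simpa using this
    have hcard : {i | c ≤ lam i}.ncard = {m | c ≤ g (s m)}.ncard := by
      rw [← Set.ncard_image_of_injective _ (Sum.inl_injective (β := ℕ)), himage,
        Set.ncard_image_of_injective _ hs]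
    have hfin' : {m | c ≤ g (s m)}.Finite := by
      refine Set.Finite.of_finite_image ?_ hs.injOn
      rw [← himage]
      exact hfin.image _
    rw [hcard]
    constructor
    · intro h
      by_contra hlt
      push Not at hlt
      have hsub : {m | c ≤ g (s m)} ⊆ Set.Iio l := by
        intro m hm
        have hm' : c ≤ g (s m) := hm
        by_contra hml
        have : g (s m) ≤ g (s l) := hanti (not_lt.mp hml)
        exact absurd (hm'.trans this) (not_le.mpr hlt)
      have := Set.ncard_le_ncard hsub (Set.finite_Iio l)
      rw [Set.ncard_Iio_nat] at this
      omega
    · intro h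
      have hsub : Set.Iic l ⊆ {m | c ≤ g (s m)} := by
        intro m hm
        have : g (s l) ≤ g (s m) := hanti hm
        exact h.trans this
      have := Set.ncard_le_ncard hsub hfin'
      rwa [Set.ncard_Iic_nat] at this
  unfold opEigenvalue
  rw [hset]
  -- When the listed value is `0` the interval is empty, and `sSup ∅ = 0` supplies the continuation
  -- by zeros.
  rcases (hg0 (s l)).eq_or_lt with h | h
  · rw [← h, Set.Ioc_self, Real.sSup_empty]
  · exact csSup_Ioc h

/-- The power sums of `opEigenvalue A` are those of the eigenvalues belonging to a Hilbert basis of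
eigenvectors. -/
theorem opEigenvalue_powerSums {A : Module.End ℝ E} (b : HilbertBasis ι ℝ E) {lam : ι → ℝ}
    (hA : ∀ i, A (b i) = lam i • b i) (hsymm : A.IsSymmetric) (hlam0 : ∀ i, 0 ≤ lam i)
    (hlam2 : Summable fun i => lam i ^ 2) :
    Antitone (opEigenvalue A) ∧ (∀ l, 0 ≤ opEigenvalue A l) ∧
      ∀ (m : ℕ) (x : ℝ), m ≠ 0 → HasSum (fun i => lam i ^ m) x →
        HasSum (fun l => opEigenvalue A l ^ m) x := by
  have hlam := tendsto_cofinite_zero_of_summable_pow hlam0 two_ne_zero hlam2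
  -- The added copy of `ℕ` carries the zeros and makes the index type infinite, as the greedy
  -- listing requires.
  set g : ι ⊕ ℕ → ℝ := Sum.elim lam (0 : ℕ → ℝ) with hg
  have hg0 : ∀ p, 0 ≤ g p := by rintro (i | i) <;> simp [hg, hlam0]
  have hsum : ∀ (m : ℕ) (x : ℝ), m ≠ 0 → HasSum (fun i => lam i ^ m) x →
      HasSum (fun p => g p ^ m) x := by
    intro m x hm hx
    rw [← (Sum.inl_injective (β := ℕ)).hasSum_iff]
    · exact hx
    · rintro (i | i) hi
      · exact absurd ⟨i, rfl⟩ hi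
      · simp [hg, hm]
  have hgt : Tendsto g cofinite (𝓝 0) :=
    tendsto_cofinite_zero_of_summable_pow hg0 two_ne_zero
      (hsum 2 _ two_ne_zero hlam2.hasSum).summable
  obtain ⟨s, hs, hanti, hle⟩ := exists_descending_listing hg0 hgt
  have hzero : ∀ p ∉ Set.range s, g p = 0 := fun p hp =>
    eq_zero_of_notMem_listing hg0 hgt hs hle hp
  have hop : opEigenvalue A = fun l => g (s l) := funext fun l =>
    opEigenvalue_eq_listing b hA hsymm hlam0 hlam hs hanti hzero l
  rw [hop]
  refine ⟨hanti, fun l => hg0 _, fun m x hm hx => ?_⟩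
  have := hsum m x hm hx
  rw [← hs.hasSum_iff] at this
  · exact this
  · intro p hp
    rw [hzero p hp, zero_pow hm]

end Sorted

/-! ### Hilbert–Schmidt operators are compact -/

/-- The operator is the norm limit of its finite-rank truncations: Cauchy–Schwarz and Bessel bound
the error by the tail of the sum of squares. -/
theorem isCompactOperator_of_summable_norm_sq {E ι : Type*} [NormedAddCommGroup E]
    [InnerProductSpace ℝ E] [CompleteSpace E] (T : E →L[ℝ] E) (b : HilbertBasis ι ℝ E)
    (h : Summable fun i => ‖T (b i)‖ ^ 2) : IsCompactOperator T := by
  classical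
  let S : Finset ι → E →L[ℝ] E := fun F => ∑ i ∈ F, (innerSL ℝ (b i)).smulRight (T (b i))
  have hS : ∀ F x, S F x = ∑ i ∈ F, inner ℝ (b i) x • T (b i) := by
    intro F x
    simp [S]
  refine isCompactOperator_of_tendsto (l := (atTop : Filter (Finset ι))) (F := S) ?_
    (Eventually.of_forall fun F => ?_)
  · rw [Metric.tendsto_atTop]
    intro ε hε
    obtain ⟨F₀, hF₀⟩ := (summable_iff_vanishing_norm.mp h) ((ε / 2) ^ 2) (by positivity)
    refine ⟨F₀, fun F hF => ?_⟩
    rw [dist_eq_norm]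
    refine lt_of_le_of_lt (ContinuousLinearMap.opNorm_le_bound _ (half_pos hε).le fun x => ?_)
      (half_lt_self hε)
    have h1 : Tendsto (fun G => S F x - S G x) atTop (𝓝 (S F x - T x)) := by
      refine Tendsto.const_sub _ ?_
      have := (b.hasSum_repr x).mapL T
      simp only [map_smul, b.repr_apply_apply] at this
      simp only [hS]
      exact this
    rw [sub_apply]
    refine le_of_tendsto h1.norm ?_
    filter_upwards [eventually_ge_atTop F] with G hG
    rw [hS, hS, ← Finset.sum_sdiff hG, sub_add_cancel_right, norm_neg]
    have h2 : ‖∑ i ∈ G \ F, inner ℝ (b i) x • T (b i)‖ ≤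
        ∑ i ∈ G \ F, ‖inner ℝ (b i) x‖ * ‖T (b i)‖ :=
      (norm_sum_le _ _).trans_eq (Finset.sum_congr rfl fun i _ => norm_smul _ _)
    refine h2.trans (abs_le_of_sq_le_sq' ?_ (by positivity)).2
    refine (Finset.sum_mul_sq_le_sq_mul_sq _ _ _).trans ?_
    rw [mul_pow, mul_comm]
    refine mul_le_mul ?_ (b.orthonormal.sum_inner_products_le x)
      (Finset.sum_nonneg fun i _ => by positivity) (by positivity)
    have h3 := hF₀ (G \ F) (Finset.disjoint_left.mpr fun i hi hi' =>
      (Finset.mem_sdiff.mp hi).2 (hF hi'))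
    exact (le_abs_self _).trans h3.le
  · have hcpt : ∀ i, IsCompactOperator ((innerSL ℝ (b i)).smulRight (T (b i)) : E →L[ℝ] E) := by
      intro i
      have h1 : IsCompactOperator (innerSL ℝ (b i) : E →L[ℝ] ℝ) :=
        ⟨Metric.closedBall 0 1, isCompact_closedBall 0 1,
          (innerSL ℝ (b i)).continuous.continuousAt.preimage_mem_nhds (by
            rw [map_zero]; exact Metric.closedBall_mem_nhds 0 one_pos)⟩
      exact h1.clm_comp ((ContinuousLinearMap.id ℝ ℝ).smulRight (T (b i)))
    induction F using Finset.induction_on with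
    | empty => simpa [S] using isCompactOperator_zero
    | insert i F hi ih =>
      have : S (insert i F) = (innerSL ℝ (b i)).smulRight (T (b i)) + S F := by
        simp only [S]
        rw [Finset.sum_insert hi]
      rw [this]
      exact (hcpt i).add ih

/-! ### The covariance operator -/

section Covariance

variable {X : Type*} [MeasurableSpace X] {k : X → X → ℝ}

theorem IsCorrelation.symm (hk : IsCorrelation k) (x y : X) : k x y = k y x := by
  simpa using (hk.posSemidef 2 ![x, y]).1.apply 1 0

theorem IsCorrelation.measurable_left (hk : IsCorrelation k) (x : X) : Measurable (k x) :=
  hk.measurable.comp measurable_prodMk_left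

theorem IsCorrelation.memLp (hk : IsCorrelation k) (μ : Measure X) [IsProbabilityMeasure μ]
    (x : X) : MemLp (k x) 2 μ :=
  MemLp.of_bound (hk.measurable_left x).aestronglyMeasurable 1
    (ae_of_all _ fun u => by simpa using hk.abs_le_one x u)

theorem inner_toLp {μ : Measure X} {f g : X → ℝ} (hf : MemLp f 2 μ) (hg : MemLp g 2 μ) :
    inner ℝ (hf.toLp f) (hg.toLp g) = ∫ x, f x * g x ∂μ := by
  rw [L2.inner_def]
  refine integral_congr_ae ?_
  filter_upwards [hf.coeFn_toLp, hg.coeFn_toLp] with x h1 h2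
  simp [h1, h2, mul_comm]

theorem inner_toLp_left {μ : Measure X} {f : X → ℝ} (hf : MemLp f 2 μ) (g : Lp ℝ 2 μ) :
    inner ℝ (hf.toLp f) g = ∫ x, f x * g x ∂μ := by
  rw [L2.inner_def]
  refine integral_congr_ae ?_
  filter_upwards [hf.coeFn_toLp] with x h1
  simp [h1, mul_comm]

theorem norm_sq_toLp {μ : Measure X} {f : X → ℝ} (hf : MemLp f 2 μ) :
    ‖hf.toLp f‖ ^ 2 = ∫ x, f x ^ 2 ∂μ := by
  rw [← real_inner_self_eq_norm_sq, inner_toLp]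
  simp only [sq]

theorem integrable_kernel_mul_mul (μ : Measure X) (hk : IsCorrelation k) {f g : X → ℝ}
    (hf : Integrable f μ) (hg : Integrable g μ) :
    Integrable (fun p : X × X => k p.1 p.2 * (f p.1 * g p.2)) (μ.prod μ) := by
  refine (hf.mul_prod hg).bdd_mul (c := 1) hk.measurable.aestronglyMeasurable
    (ae_of_all _ fun p => by simpa using hk.abs_le_one p.1 p.2)

variable (μ : Measure X) [IsProbabilityMeasure μ]

theorem norm_toLp_le_one {f : X → ℝ} (hf : MemLp f 2 μ) (h : ∀ x, |f x| ≤ 1) :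
    ‖hf.toLp f‖ ≤ 1 := by
  rw [← sq_le_one_iff₀ (norm_nonneg _), norm_sq_toLp]
  calc ∫ x, f x ^ 2 ∂μ ≤ ∫ _, (1 : ℝ) ∂μ :=
        integral_mono hf.integrable_sq (integrable_const _) fun x =>
          (sq_le_one_iff_abs_le_one _).mpr (h x)
    _ = 1 := by simp

theorem norm_covOperator_le (hk : IsCorrelation k) (f : Lp ℝ 2 μ) :
    ‖covOperator hk μ f‖ ≤ 1 * ‖f‖ := by
  rw [one_mul]
  refine abs_le_of_sq_le_sq' ?_ (norm_nonneg _) |>.2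
  change ‖(hk.memLp_integral μ f).toLp _‖ ^ 2 ≤ _
  rw [norm_sq_toLp]
  calc ∫ x, (∫ u, k x u * f u ∂μ) ^ 2 ∂μ ≤ ∫ _, ‖f‖ ^ 2 ∂μ := by
        refine integral_mono (hk.memLp_integral μ f).integrable_sq (integrable_const _)
          fun x => ?_
        have h1 := abs_real_inner_le_norm ((hk.memLp μ x).toLp _) f
        rw [inner_toLp_left] at h1
        have h2 := h1.trans (mul_le_of_le_one_left (norm_nonneg _)
          (norm_toLp_le_one μ (hk.memLp μ x) (hk.abs_le_one x)))
        exact sq_le_sq' (abs_le.mp h2).1 (abs_le.mp h2).2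
    _ = ‖f‖ ^ 2 := by simp

/-- The covariance operator as a continuous linear map. -/
noncomputable def covCLM (hk : IsCorrelation k) : Lp ℝ 2 μ →L[ℝ] Lp ℝ 2 μ :=
  (covOperator hk μ).mkContinuous 1 (norm_covOperator_le μ hk)

theorem inner_covOperator (hk : IsCorrelation k) (f g : Lp ℝ 2 μ) :
    inner ℝ (covOperator hk μ f) g = ∫ p, k p.1 p.2 * (g p.1 * f p.2) ∂(μ.prod μ) := by
  have hf : Integrable f μ := (Lp.memLp f).integrable (by norm_num)
  have hg : Integrable g μ := (Lp.memLp g).integrable (by norm_num)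
  change inner ℝ ((hk.memLp_integral μ f).toLp _) g = _
  rw [inner_toLp_left, integral_prod _ (integrable_kernel_mul_mul μ hk hg hf)]
  refine integral_congr_ae (ae_of_all _ fun x => ?_)
  dsimp only
  rw [← integral_mul_const]
  exact integral_congr_ae (ae_of_all _ fun u => by ring)

theorem covOperator_isSymmetric (hk : IsCorrelation k) : (covOperator hk μ).IsSymmetric := by
  intro f g
  rw [real_inner_comm _ f, inner_covOperator, inner_covOperator, ← integral_prod_swap]
  refine integral_congr_ae (ae_of_all _ fun p => ?_)
  simp only [Prod.fst_swap, Prod.snd_swap]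
  rw [hk.symm]
  ring

/-- At each `x` the integrand is a Bessel sum for the section `k x`, whose norm is at most `1`. The
bound gives both compactness and square-summability of the eigenvalues. -/
theorem sum_norm_sq_covOperator_le (hk : IsCorrelation k) {ι : Type*} {v : ι → Lp ℝ 2 μ}
    (hv : Orthonormal ℝ v) (F : Finset ι) : ∑ i ∈ F, ‖covOperator hk μ (v i)‖ ^ 2 ≤ 1 := by
  have h1 : ∀ i, ‖covOperator hk μ (v i)‖ ^ 2 = ∫ x, (∫ u, k x u * v i u ∂μ) ^ 2 ∂μ := fun i =>
    norm_sq_toLp (hk.memLp_integral μ (v i))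
  simp only [h1]
  rw [← integral_finsetSum _ fun i _ => (hk.memLp_integral μ (v i)).integrable_sq]
  calc _ ≤ ∫ _, (1 : ℝ) ∂μ := by
        refine integral_mono
          (integrable_finsetSum _ fun i _ => (hk.memLp_integral μ (v i)).integrable_sq)
          (integrable_const _) fun x => ?_
        have h2 := hv.sum_inner_products_le ((hk.memLp μ x).toLp _) (s := F)
        have h3 := norm_toLp_le_one μ (hk.memLp μ x) (hk.abs_le_one x)
        refine le_trans (le_of_eq ?_) (h2.trans (pow_le_one₀ (norm_nonneg _) h3))
        refine Finset.sum_congr rfl fun i _ => ?_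
        rw [real_inner_comm, inner_toLp_left, Real.norm_eq_abs, sq_abs]
    _ = 1 := by simp

theorem isCompactOperator_covCLM (hk : IsCorrelation k) : IsCompactOperator (covCLM μ hk) := by
  obtain ⟨w, b, -⟩ := exists_hilbertBasis ℝ (Lp ℝ 2 μ)
  refine isCompactOperator_of_summable_norm_sq _ b ?_
  exact summable_of_sum_le (c := 1) (fun i => sq_nonneg _) fun F =>
    sum_norm_sq_covOperator_le μ hk b.orthonormal F

/-- Positivity of the kernel matrix at `n` independent points, tested against the values of `f` and
averaged, gives `0 ≤ n * N + n * (n - 1) * Q`: diagonal terms contribute `N`, the others `Q`.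
Letting `n` grow yields `0 ≤ Q` for a kernel that is merely measurable. -/
theorem inner_covOperator_self_nonneg (hk : IsCorrelation k) (f : Lp ℝ 2 μ) :
    0 ≤ inner ℝ (covOperator hk μ f) f := by
  rw [inner_covOperator]
  have hf : Integrable f μ := (Lp.memLp f).integrable (by norm_num)
  set Q := ∫ p, k p.1 p.2 * (f p.1 * f p.2) ∂(μ.prod μ)
  set N := ∫ x, f x ^ 2 ∂μ
  have hGm : AEStronglyMeasurable (fun p : X × X => k p.1 p.2 * (f p.1 * f p.2)) (μ.prod μ) :=
    (integrable_kernel_mul_mul μ hk hf hf).1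
  have hfin : ∀ n : ℕ, 0 ≤ (n : ℝ) * N + (n : ℝ) * (n - 1) * Q := by
    intro n
    let ν : Measure (Fin n → X) := Measure.pi fun _ => μ
    have heval : ∀ a : Fin n, MeasurePreserving (fun x : Fin n → X => x a) ν μ := fun a =>
      measurePreserving_eval (fun _ => μ) a
    have hpair : ∀ a b : Fin n, a ≠ b →
        MeasurePreserving (fun x : Fin n → X => (x a, x b)) ν (μ.prod μ) := by
      intro a b hab
      refine ⟨by fun_prop, ?_⟩
      have hind := (iIndepFun_pi (μ := fun _ : Fin n => μ) (X := fun _ x => x)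
        fun _ => aemeasurable_id).indepFun hab
      rw [indepFun_iff_map_prod_eq_prod_map_map (measurable_pi_apply a).aemeasurable
        (measurable_pi_apply b).aemeasurable] at hind
      rw [hind, (heval a).map_eq, (heval b).map_eq]
    have hterm : ∀ a b : Fin n,
        Integrable (fun x : Fin n → X => k (x a) (x b) * (f (x a) * f (x b))) ν ∧
        ∫ x, k (x a) (x b) * (f (x a) * f (x b)) ∂ν = if a = b then N else Q := by
      intro a b
      by_cases hab : a = b
      · subst hab
        simp only [hk.diag, one_mul, if_true]
        have h1 : ∀ y, f y * f y = f y ^ 2 := fun y => (sq _).symm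
        simp only [h1]
        have hint : Integrable (fun y => f y ^ 2) μ := (Lp.memLp f).integrable_sq
        constructor
        · exact (heval a).integrable_comp_of_integrable hint
        · have := integral_map (heval a).measurable.aemeasurable
            (f := fun y => f y ^ 2) (by rw [(heval a).map_eq]; exact hint.1)
          rw [(heval a).map_eq] at this
          exact this.symm
      · rw [if_neg hab]
        constructor
        · exact (hpair a b hab).integrable_comp_of_integrable
            (integrable_kernel_mul_mul μ hk hf hf)
        · have := integral_map (hpair a b hab).measurable.aemeasurable
            (f := fun p : X × X => k p.1 p.2 * (f p.1 * f p.2))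
            (by rw [(hpair a b hab).map_eq]; exact hGm)
          rw [(hpair a b hab).map_eq] at this
          exact this.symm
    have hpos : 0 ≤ ∫ x, ∑ a, ∑ b, k (x a) (x b) * (f (x a) * f (x b)) ∂ν := by
      refine integral_nonneg fun x => ?_
      have := (hk.posSemidef n x).dotProduct_mulVec_nonneg fun a => f (x a)
      simp only [dotProduct, Matrix.mulVec, Matrix.of_apply, Finset.mul_sum, star_trivial] at this
      refine this.trans_eq (Finset.sum_congr rfl fun a _ => Finset.sum_congr rfl fun b _ => ?_)
      ring
    rw [integral_finsetSum _ fun a _ => integrable_finsetSum _ fun b _ => (hterm a b).1] at hpos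
    simp only [integral_finsetSum _ fun b _ => (hterm _ b).1, (hterm _ _).2] at hpos
    refine hpos.trans_eq ?_
    have hsplit : ∀ a b : Fin n, (if a = b then N else Q) = (if a = b then N - Q else 0) + Q := by
      intro a b; split_ifs <;> ring
    simp only [hsplit, Finset.sum_add_distrib, Finset.sum_ite_eq, Finset.mem_univ, if_true,
      Finset.sum_const, Finset.card_univ, Fintype.card_fin, nsmul_eq_mul]
    ring
  by_contra hQ
  push Not at hQ
  obtain ⟨n, hn⟩ := exists_nat_gt (N / -Q)
  have h1 := hfin (n + 1)
  rw [div_lt_iff₀ (by linarith)] at hn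
  push_cast at h1
  have h2 : ((n : ℝ) + 1) * (N + n * Q) < 0 :=
    mul_neg_of_pos_of_neg (by positivity) (by linarith)
  linarith

end Covariance

/-! ### Iterated kernels and their traces -/

/-- The kernel of the `(q + 1)`-st power of the integral operator with kernel `k`. -/
noncomputable def iterKernel {X : Type*} [MeasurableSpace X] (k : X → X → ℝ) (μ : Measure X) :
    ℕ → X → X → ℝ
  | 0 => k
  | q + 1 => fun x y => ∫ u, k x u * iterKernel k μ q u y ∂μ

/-- The trace of the `(q + 1)`-st power of the integral operator with kernel `k`. -/
noncomputable def kernelTrace {X : Type*} [MeasurableSpace X] (k : X → X → ℝ) (μ : Measure X)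
    (q : ℕ) : ℝ :=
  ∫ x, iterKernel k μ q x x ∂μ

section

variable {X : Type*} [MeasurableSpace X] {k : X → X → ℝ}

theorem measurable_iterKernel (hk : Measurable (Function.uncurry k)) (μ : Measure X) [SFinite μ]
    (q : ℕ) : Measurable (Function.uncurry (iterKernel k μ q)) := by
  induction q with
  | zero => exact hk
  | succ q ih =>
    have h : Measurable (Function.uncurry fun (p : X × X) u =>
        k p.1 u * iterKernel k μ q u p.2) :=
      (hk.comp (measurable_fst.fst.prodMk measurable_snd)).mul
        (ih.comp (measurable_snd.prodMk measurable_fst.snd))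
    exact (h.stronglyMeasurable.integral_prod_right).measurable

theorem abs_iterKernel_le_one (hk1 : ∀ x y, |k x y| ≤ 1) (μ : Measure X) [IsProbabilityMeasure μ]
    (q : ℕ) (x y : X) : |iterKernel k μ q x y| ≤ 1 := by
  induction q generalizing x y with
  | zero => exact hk1 x y
  | succ q ih =>
    have := norm_integral_le_of_norm_le_const (μ := μ) (C := 1)
      (f := fun u => k x u * iterKernel k μ q u y) (ae_of_all _ fun u => by
        rw [Real.norm_eq_abs, abs_mul]
        exact mul_le_one₀ (hk1 x u) (abs_nonneg _) (ih u y))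
    simpa [iterKernel] using this

theorem integrable_of_abs_le_one {Y : Type*} [MeasurableSpace Y] {μ : Measure Y}
    [IsFiniteMeasure μ] {f : Y → ℝ} (hf : Measurable f) (h : ∀ x, |f x| ≤ 1) : Integrable f μ :=
  Integrable.of_bound hf.aestronglyMeasurable 1 (ae_of_all _ h)

theorem iterKernel_add (hk : Measurable (Function.uncurry k)) (hk1 : ∀ x y, |k x y| ≤ 1)
    (μ : Measure X) [IsProbabilityMeasure μ] (p q : ℕ) (x y : X) :
    iterKernel k μ (p + q + 1) x y =
      ∫ u, iterKernel k μ p x u * iterKernel k μ q u y ∂μ := by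
  have hm := measurable_iterKernel hk μ
  have hle := abs_iterKernel_le_one hk1 μ
  induction p generalizing x y with
  | zero => rw [Nat.zero_add]; rfl
  | succ p ih =>
    have h0 : p + 1 + q + 1 = p + q + 1 + 1 := by omega
    rw [h0, iterKernel]
    simp only [ih]
    calc ∫ v, k x v * ∫ u, iterKernel k μ p v u * iterKernel k μ q u y ∂μ ∂μ
        = ∫ v, ∫ u, k x v * (iterKernel k μ p v u * iterKernel k μ q u y) ∂μ ∂μ := by
          simp only [integral_const_mul]
      _ = ∫ u, ∫ v, k x v * (iterKernel k μ p v u * iterKernel k μ q u y) ∂μ ∂μ := by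
          refine integral_integral_swap (integrable_of_abs_le_one ?_ fun z => ?_)
          · exact (hk.comp (measurable_const.prodMk measurable_fst)).mul
              ((hm p).mul ((hm q).comp (measurable_snd.prodMk measurable_const)))
          · change |k x z.1 * (iterKernel k μ p z.1 z.2 * iterKernel k μ q z.2 y)| ≤ 1
            rw [abs_mul, abs_mul]
            exact mul_le_one₀ (hk1 _ _) (by positivity)
              (mul_le_one₀ (hle _ _ _) (abs_nonneg _) (hle _ _ _))
      _ = ∫ u, iterKernel k μ (p + 1) x u * iterKernel k μ q u y ∂μ := by
          refine integral_congr_ae (ae_of_all _ fun u => ?_)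
          dsimp only
          rw [iterKernel, ← integral_mul_const]
          exact integral_congr_ae (ae_of_all _ fun v => by ring)

theorem iterKernel_symm (hk : Measurable (Function.uncurry k)) (hk1 : ∀ x y, |k x y| ≤ 1)
    (hs : ∀ x y, k x y = k y x) (μ : Measure X) [IsProbabilityMeasure μ] (q : ℕ) (x y : X) :
    iterKernel k μ q x y = iterKernel k μ q y x := by
  induction q generalizing x y with
  | zero => exact hs x y
  | succ q ih =>
    have h := iterKernel_add hk hk1 μ q 0 y x
    rw [Nat.add_zero] at h
    rw [h, iterKernel]
    refine integral_congr_ae (ae_of_all _ fun u => ?_)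
    dsimp only
    rw [ih u y, hs x u, mul_comm]

theorem memLp_iterKernel (hk : IsCorrelation k) (μ : Measure X) [IsProbabilityMeasure μ] (q : ℕ)
    (x : X) : MemLp (iterKernel k μ q x) 2 μ :=
  MemLp.of_bound
    ((measurable_iterKernel hk.measurable μ q).comp measurable_prodMk_left).aestronglyMeasurable 1
    (ae_of_all _ fun u => by simpa using abs_iterKernel_le_one hk.abs_le_one μ q x u)

/-- One application of the kernel is kept as an integral instead of becoming a further factor `c`:
the integral is defined at every `x`, whereas `e x` is defined only almost everywhere. -/
theorem inner_iterKernel_eigenvector (hk : IsCorrelation k) (μ : Measure X)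
    [IsProbabilityMeasure μ] {e : Lp ℝ 2 μ} {c : ℝ} (he : covOperator hk μ e = c • e) (q : ℕ)
    (x : X) : inner ℝ ((memLp_iterKernel hk μ q x).toLp _) e = c ^ q * ∫ u, k x u * e u ∂μ := by
  induction q with
  | zero => rw [inner_toLp_left, pow_zero, one_mul]; rfl
  | succ q ih =>
    have h1 : (memLp_iterKernel hk μ (q + 1) x).toLp _ =
        covOperator hk μ ((memLp_iterKernel hk μ q x).toLp _) := by
      refine MemLp.toLp_congr _ (hk.memLp_integral μ _) (ae_of_all _ fun y => ?_)
      have h2 := iterKernel_add hk.measurable hk.abs_le_one μ q 0 x y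
      rw [Nat.add_zero] at h2
      rw [h2]
      refine integral_congr_ae ?_
      filter_upwards [(memLp_iterKernel hk μ q x).coeFn_toLp] with u hu
      rw [hu, hk.symm y u, mul_comm]
      rfl
    rw [h1, covOperator_isSymmetric μ hk, he, inner_smul_right, ih, pow_succ']
    ring

/-- On the diagonal an even iterate is the squared norm of the section of the iterate of half the
order. Parseval for this section holds at every `x`, so Mercer's theorem is not needed. -/
theorem hasSum_sq_iterKernel (hk : IsCorrelation k) (μ : Measure X) [IsProbabilityMeasure μ]
    {ι : Type*} (b : HilbertBasis ι ℝ (Lp ℝ 2 μ)) {lam : ι → ℝ}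
    (hb : ∀ i, covOperator hk μ (b i) = lam i • b i) (q : ℕ) (x : X) :
    HasSum (fun i => (lam i ^ q * ∫ u, k x u * b i u ∂μ) ^ 2)
      (iterKernel k μ (2 * q + 1) x x) := by
  set f := (memLp_iterKernel hk μ q x).toLp _
  have h1 := b.hasSum_inner_mul_inner f f
  have h2 : ∀ i, inner ℝ f (b i) * inner ℝ (b i) f =
      (lam i ^ q * ∫ u, k x u * b i u ∂μ) ^ 2 := by
    intro i
    rw [real_inner_comm f, ← sq, inner_iterKernel_eigenvector hk μ (hb i)]
  have h3 : iterKernel k μ (2 * q + 1) x x = inner ℝ f f := by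
    rw [inner_toLp, two_mul, iterKernel_add hk.measurable hk.abs_le_one]
    refine integral_congr_ae (ae_of_all _ fun u => ?_)
    dsimp only
    rw [iterKernel_symm hk.measurable hk.abs_le_one hk.symm μ q u x]
  simp only [h2] at h1
  exact h3 ▸ h1

theorem hasSum_pow_kernelTrace (hk : IsCorrelation k) (μ : Measure X) [IsProbabilityMeasure μ]
    {ι : Type*} (b : HilbertBasis ι ℝ (Lp ℝ 2 μ)) {lam : ι → ℝ}
    (hb : ∀ i, covOperator hk μ (b i) = lam i • b i) (hlam0 : ∀ i, 0 ≤ lam i)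
    (hlam1 : ∀ i, lam i ≤ 1) (hlam2 : Summable fun i => lam i ^ 2) (q : ℕ) :
    HasSum (fun i => lam i ^ (2 * q + 4)) (kernelTrace k μ (2 * q + 3)) := by
  -- Exchanging sum and integral needs a countable index set, but the basis may be uncountable. The
  -- factor `lam i ^ (q + 1)` kills every term outside the countable set of nonzero eigenvalues;
  -- this is why the orders start at `4`.
  set s : Set ι := Function.support fun i => lam i ^ 2
  have hcount : Countable s := hlam2.countable_support
  let F : ι → X → ℝ := fun i x => (lam i ^ (q + 1) * ∫ u, k x u * b i u ∂μ) ^ 2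
  have hnotMem : ∀ i ∉ s, lam i = 0 := fun i hi => by simpa [s] using hi
  have hF : ∀ x, HasSum (fun i : s => F i x) (iterKernel k μ (2 * q + 3) x x) := by
    intro x
    have h1 := hasSum_sq_iterKernel hk μ b hb (q + 1) x
    rw [← hasSum_subtype_iff_of_support_subset (s := s)] at h1
    · exact h1
    · intro i hi
      by_contra h
      exact hi (by simp [hnotMem i h])
  have hint : ∀ i, Integrable (F i) μ := fun i => by
    simp only [F, mul_pow]
    exact (hk.memLp_integral μ (b i)).integrable_sq.const_mul _
  have hFint : ∀ i, ∫ x, F i x ∂μ = lam i ^ (2 * q + 4) := by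
    intro i
    simp only [F, mul_pow]
    rw [integral_const_mul, ← norm_sq_toLp (hk.memLp_integral μ (b i))]
    change _ * ‖covOperator hk μ (b i)‖ ^ 2 = _
    rw [hb, norm_smul, b.orthonormal.norm_eq_one, mul_one, Real.norm_eq_abs, sq_abs]
    ring
  have hsum : Summable fun i => lam i ^ (2 * q + 4) :=
    hlam2.pow_of_le hlam0 hlam1 (by omega)
  have h2 := hasSum_integral_of_summable_integral_norm (F := fun i : s => F i)
    (fun i => hint i) (by
      have : ∀ i : s, ∫ x, ‖F i x‖ ∂μ = lam i ^ (2 * q + 4) := fun i => by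
        rw [← hFint]
        exact integral_congr_ae (ae_of_all _ fun x => Real.norm_of_nonneg (sq_nonneg _))
      simp only [this]
      exact hsum.subtype s)
  simp only [hFint, (hF _).tsum_eq] at h2
  refine (hasSum_subtype_iff_of_support_subset (f := fun i => lam i ^ (2 * q + 4)) ?_).mp h2
  intro i hi
  by_contra h
  exact hi (by simp [hnotMem i h])

theorem opEigenvalue_covOperator (hk : IsCorrelation k) (μ : Measure X) [IsProbabilityMeasure μ] :
    Antitone (opEigenvalue (covOperator hk μ)) ∧ (∀ l, 0 ≤ opEigenvalue (covOperator hk μ) l) ∧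
      ∀ q : ℕ, HasSum (fun l => opEigenvalue (covOperator hk μ) l ^ (2 * q + 4))
        (kernelTrace k μ (2 * q + 3)) := by
  obtain ⟨w, b, hb⟩ := exists_hilbertBasis_eigenvectors (isCompactOperator_covCLM μ hk)
    (covOperator_isSymmetric μ hk)
  have hb' : ∀ p, covOperator hk μ (b p) = p.1 • b p := hb
  have hinner : ∀ p, inner ℝ (covOperator hk μ (b p)) (b p) = p.1 := fun p => by
    rw [hb', inner_smul_left, real_inner_self_eq_norm_sq, b.orthonormal.norm_eq_one]
    simp
  have hnorm : ∀ p, ‖covOperator hk μ (b p)‖ = |p.1| := fun p => by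
    rw [hb', norm_smul, b.orthonormal.norm_eq_one, mul_one, Real.norm_eq_abs]
  have hlam0 : ∀ p : Σ c, w c, 0 ≤ p.1 := fun p => by
    rw [← hinner]
    exact inner_covOperator_self_nonneg μ hk _
  have hlam1 : ∀ p : Σ c, w c, p.1 ≤ 1 := fun p => by
    have := norm_covOperator_le μ hk (b p)
    rw [hnorm, b.orthonormal.norm_eq_one, mul_one] at this
    exact (abs_le.mp this).2
  have hlam2 : Summable fun p : Σ c, w c => p.1 ^ 2 := by
    refine summable_of_sum_le (c := 1) (fun i => sq_nonneg _) fun F => ?_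
    have := sum_norm_sq_covOperator_le μ hk b.orthonormal F
    simpa only [hnorm, sq_abs] using this
  obtain ⟨h1, h2, h3⟩ := opEigenvalue_powerSums b hb' (covOperator_isSymmetric μ hk) hlam0 hlam2
  exact ⟨h1, h2, fun q => h3 _ _ (by omega)
    (hasSum_pow_kernelTrace hk μ b hb' hlam0 hlam1 hlam2 q)⟩

/-! ### Traces of separable and of pulled back kernels -/

/-- This allows kernels on a factor, or on a coarser space, to be treated as kernels on `S × T`. -/
theorem kernelTrace_comp {Y : Type*} [MeasurableSpace Y] {φ : Y → X} (hφ : Measurable φ)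
    (hk : Measurable (Function.uncurry k)) (ν : Measure Y) [IsProbabilityMeasure ν] (q : ℕ) :
    kernelTrace (fun y y' => k (φ y) (φ y')) ν q = kernelTrace k (ν.map φ) q := by
  have hprob : IsProbabilityMeasure (ν.map φ) := Measure.isProbabilityMeasure_map hφ.aemeasurable
  have hm := measurable_iterKernel hk (ν.map φ)
  have h : ∀ y y', iterKernel (fun y y' => k (φ y) (φ y')) ν q y y' =
      iterKernel k (ν.map φ) q (φ y) (φ y') := by
    induction q with
    | zero => exact fun y y' => rfl
    | succ q ih =>
      intro y y'
      simp only [iterKernel, ih]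
      rw [integral_map hφ.aemeasurable]
      exact ((hk.comp measurable_prodMk_left).mul
        ((hm q).comp measurable_prodMk_right)).aestronglyMeasurable
  unfold kernelTrace
  simp only [h]
  rw [integral_map hφ.aemeasurable]
  exact ((hm q).comp (measurable_id.prodMk measurable_id)).aestronglyMeasurable

theorem kernelTrace_separableKernel {Y : Type*} [MeasurableSpace Y] (l : Y → Y → ℝ)
    (μ : Measure X) (ν : Measure Y) [SFinite μ] [SFinite ν] (q : ℕ) :
    kernelTrace (separableKernel k l) (μ.prod ν) q = kernelTrace k μ q * kernelTrace l ν q := by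
  have h : ∀ p p', iterKernel (separableKernel k l) (μ.prod ν) q p p' =
      iterKernel k μ q p.1 p'.1 * iterKernel l ν q p.2 p'.2 := by
    induction q with
    | zero => exact fun y y' => rfl
    | succ q ih =>
      intro y y'
      simp only [iterKernel, ih, separableKernel]
      rw [← integral_prod_mul]
      exact integral_congr_ae (ae_of_all _ fun u => by ring)
  unfold kernelTrace
  simp only [h]
  exact integral_prod_mul (fun x => iterKernel k μ q x x) fun y => iterKernel l ν q y y

end

/-! ### Closed walks -/

/-- The product `k x c₀ * k c₀ c₁ * ⋯ * k c_{q-1} y` of the kernel along a walk. -/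
def walkWeight {X : Type*} (k : X → X → ℝ) : (q : ℕ) → X → X → (Fin q → X) → ℝ
  | 0, x, y, _ => k x y
  | q + 1, x, y, c => k x (c 0) * walkWeight k q (c 0) y (Fin.tail c)

/-- The product of the kernel along a closed walk with `q + 1` vertices. -/
def closedWalkWeight {X : Type*} (k : X → X → ℝ) (q : ℕ) (c : Fin (q + 1) → X) : ℝ :=
  walkWeight k q (c 0) (c 0) (Fin.tail c)

theorem walkWeight_comp {X Y : Type*} (k : X → X → ℝ) (φ : Y → X) (q : ℕ) (x y : Y)
    (c : Fin q → Y) :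
    walkWeight k q (φ x) (φ y) (φ ∘ c) = walkWeight (fun y y' => k (φ y) (φ y')) q x y c := by
  induction q generalizing x with
  | zero => rfl
  | succ q ih => exact congrArg _ (ih (c 0) (Fin.tail c))

theorem closedWalkWeight_comp {X Y : Type*} (k : X → X → ℝ) (φ : Y → X) (q : ℕ)
    (c : Fin (q + 1) → Y) :
    closedWalkWeight k q (φ ∘ c) = closedWalkWeight (fun y y' => k (φ y) (φ y')) q c :=
  walkWeight_comp k φ q (c 0) (c 0) (Fin.tail c)

theorem abs_walkWeight_le_one {X : Type*} {k : X → X → ℝ} (hk : ∀ x y, |k x y| ≤ 1) (q : ℕ)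
    (x y : X) (c : Fin q → X) : |walkWeight k q x y c| ≤ 1 := by
  induction q generalizing x with
  | zero => exact hk x y
  | succ q ih =>
    rw [walkWeight, abs_mul]
    exact mul_le_one₀ (hk _ _) (abs_nonneg _) (ih _ _)

theorem continuous_walkWeight {X : Type*} [TopologicalSpace X] {k : X → X → ℝ}
    (hk : Continuous (Function.uncurry k)) (q : ℕ) :
    Continuous fun p : X × X × (Fin q → X) => walkWeight k q p.1 p.2.1 p.2.2 := by
  induction q with
  | zero => exact hk.comp (continuous_fst.prodMk continuous_snd.fst)
  | succ q ih =>
    have h0 : Continuous fun p : X × X × (Fin (q + 1) → X) => p.2.2 0 :=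
      (continuous_apply 0).comp continuous_snd.snd
    have ht : Continuous fun p : X × X × (Fin (q + 1) → X) => Fin.tail p.2.2 :=
      continuous_pi fun i => (continuous_apply i.succ).comp continuous_snd.snd
    exact (hk.comp (continuous_fst.prodMk h0)).mul
      (ih.comp (h0.prodMk (continuous_snd.fst.prodMk ht)))

theorem continuous_closedWalkWeight {X : Type*} [TopologicalSpace X] {k : X → X → ℝ}
    (hk : Continuous (Function.uncurry k)) (q : ℕ) : Continuous (closedWalkWeight k q) := by
  have ht : Continuous fun c : Fin (q + 1) → X => Fin.tail c :=
    continuous_pi fun i => continuous_apply i.succ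
  exact (continuous_walkWeight hk q).comp
    ((continuous_apply 0).prodMk ((continuous_apply 0).prodMk ht))

section

variable {X : Type*} [MeasurableSpace X] {k : X → X → ℝ}

theorem measurable_finTail (q : ℕ) : Measurable fun c : Fin (q + 1) → X => Fin.tail c :=
  measurable_pi_lambda _ fun i => measurable_pi_apply i.succ

theorem measurable_walkWeight (hk : Measurable (Function.uncurry k)) (q : ℕ) :
    Measurable fun p : X × X × (Fin q → X) => walkWeight k q p.1 p.2.1 p.2.2 := by
  induction q with
  | zero => exact hk.comp (measurable_fst.prodMk measurable_snd.fst)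
  | succ q ih =>
    have h0 : Measurable fun p : X × X × (Fin (q + 1) → X) => p.2.2 0 :=
      (measurable_pi_apply 0).comp measurable_snd.snd
    have ht : Measurable fun p : X × X × (Fin (q + 1) → X) => Fin.tail p.2.2 :=
      (measurable_finTail q).comp measurable_snd.snd
    exact (hk.comp (measurable_fst.prodMk h0)).mul
      (ih.comp (h0.prodMk (measurable_snd.fst.prodMk ht)))

theorem measurable_closedWalkWeight (hk : Measurable (Function.uncurry k)) (q : ℕ) :
    Measurable (closedWalkWeight k q) :=
  (measurable_walkWeight hk q).comp
    ((measurable_pi_apply 0).prodMk ((measurable_pi_apply 0).prodMk (measurable_finTail q)))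

theorem measurePreserving_zero_tail (μ : Measure X) [SigmaFinite μ] (q : ℕ) :
    MeasurePreserving (fun c : Fin (q + 1) → X => (c 0, Fin.tail c))
      (Measure.pi fun _ => μ) (μ.prod (Measure.pi fun _ => μ)) := by
  have h := measurePreserving_piFinSuccAbove (fun _ : Fin (q + 1) => μ) 0
  have heq : (fun c : Fin (q + 1) → X => (c 0, Fin.tail c)) =
      MeasurableEquiv.piFinSuccAbove (fun _ => X) 0 := by
    funext c
    exact Prod.ext rfl (Fin.removeNth_zero c).symm
  rw [heq]
  exact h

theorem integral_walkWeight (hk : Measurable (Function.uncurry k)) (hk1 : ∀ x y, |k x y| ≤ 1)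
    (μ : Measure X) [IsProbabilityMeasure μ] (q : ℕ) (x y : X) :
    ∫ c, walkWeight k q x y c ∂(Measure.pi fun _ => μ) = iterKernel k μ q x y := by
  induction q generalizing x with
  | zero => simp [walkWeight, iterKernel]
  | succ q ih =>
    let G : X × (Fin q → X) → ℝ := fun p => k x p.1 * walkWeight k q p.1 y p.2
    have hG : Measurable G :=
      (hk.comp (measurable_const.prodMk measurable_fst)).mul ((measurable_walkWeight hk q).comp
        (measurable_fst.prodMk (measurable_const.prodMk measurable_snd)))
    have hG1 : ∀ p, |G p| ≤ 1 := fun p => by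
      simp only [G]
      rw [abs_mul]
      exact mul_le_one₀ (hk1 _ _) (abs_nonneg _) (abs_walkWeight_le_one hk1 _ _ _ _)
    have hmp := measurePreserving_zero_tail μ q
    have h1 := integral_map (μ := Measure.pi fun _ => μ) hmp.measurable.aemeasurable
      (f := G) hG.aestronglyMeasurable
    rw [hmp.map_eq, integral_prod _ (integrable_of_abs_le_one hG hG1)] at h1
    refine h1.symm.trans (integral_congr_ae (ae_of_all _ fun u => ?_))
    simp only [G]
    rw [integral_const_mul, ih]

theorem integral_closedWalkWeight (hk : Measurable (Function.uncurry k))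
    (hk1 : ∀ x y, |k x y| ≤ 1) (μ : Measure X) [IsProbabilityMeasure μ] (q : ℕ) :
    ∫ c, closedWalkWeight k q c ∂(Measure.pi fun _ => μ) = kernelTrace k μ q := by
  let G : X × (Fin q → X) → ℝ := fun p => walkWeight k q p.1 p.1 p.2
  have hG : Measurable G := (measurable_walkWeight hk q).comp
    (measurable_fst.prodMk (measurable_fst.prodMk measurable_snd))
  have hmp := measurePreserving_zero_tail μ q
  have h1 := integral_map (μ := Measure.pi fun _ => μ) hmp.measurable.aemeasurable
      (f := G) hG.aestronglyMeasurable
  rw [hmp.map_eq, integral_prod _ (integrable_of_abs_le_one hG fun p =>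
    abs_walkWeight_le_one hk1 _ _ _ _)] at h1
  refine h1.symm.trans (integral_congr_ae (ae_of_all _ fun u => ?_))
  exact integral_walkWeight hk hk1 μ q u u

end

theorem sum_finTail {α : Type*} [Fintype α] (q : ℕ) (F : α → (Fin q → α) → ℝ) :
    ∑ c : Fin (q + 1) → α, F (c 0) (Fin.tail c) = ∑ a, ∑ c : Fin q → α, F a c := by
  rw [← Fintype.sum_prod_type', ← (Fin.consEquiv fun _ : Fin (q + 1) => α).symm.sum_comp]
  rfl

theorem sum_walkWeight {n : ℕ} (M : Matrix (Fin n) (Fin n) ℝ) (q : ℕ) (a b : Fin n) :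
    ∑ c : Fin q → Fin n, walkWeight M q a b c = (M ^ (q + 1)) a b := by
  induction q generalizing a with
  | zero => simp [walkWeight]
  | succ q ih =>
    simp only [walkWeight]
    rw [sum_finTail q fun d c => M a d * walkWeight M q d b c, pow_succ', Matrix.mul_apply]
    simp only [← Finset.mul_sum, ih]

theorem sum_closedWalkWeight {n : ℕ} (M : Matrix (Fin n) (Fin n) ℝ) (q : ℕ) :
    ∑ c : Fin (q + 1) → Fin n, closedWalkWeight M q c = (M ^ (q + 1)).trace := by
  simp only [closedWalkWeight]
  rw [sum_finTail q fun d c => walkWeight M q d d c, Matrix.trace]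
  simp only [sum_walkWeight, Matrix.diag]

/-! ### Eigenvalues of kernel matrices -/

theorem trace_pow_eq_sum_eigenvalues₀ {n : ℕ} {A : Matrix (Fin n) (Fin n) ℝ} (hA : A.IsHermitian)
    (p : ℕ) : (A ^ p).trace = ∑ i, hA.eigenvalues₀ i ^ p := by
  conv_lhs => rw [hA.spectral_theorem, ← map_pow, Unitary.conjStarAlgAut_apply,
    Matrix.trace_mul_cycle, Unitary.coe_star_mul_self, one_mul, Matrix.diagonal_pow,
    Matrix.trace_diagonal]
  exact (Fintype.equivOfCardEq (Fintype.card_fin _)).symm.sum_comp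
    fun i => hA.eigenvalues₀ i ^ p

theorem matEigenvalue_nonneg {n : ℕ} {A : Matrix (Fin n) (Fin n) ℝ} (hA : A.PosSemidef) (i : ℕ) :
    0 ≤ matEigenvalue A i := by
  unfold matEigenvalue
  split_ifs with h
  · have h1 := hA.eigenvalues_nonneg (Fintype.equivOfCardEq (Fintype.card_fin _)
      (⟨i, (Fintype.card_fin n).symm ▸ h.2⟩ : Fin (Fintype.card (Fin n))))
    simpa only [Matrix.IsHermitian.eigenvalues, Equiv.symm_apply_apply] using h1
  · exact le_refl 0

theorem matEigenvalue_of_le {n i : ℕ} (A : Matrix (Fin n) (Fin n) ℝ) (hi : n ≤ i) :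
    matEigenvalue A i = 0 := dif_neg fun h => absurd h.2 (not_lt.mpr hi)

theorem antitone_matEigenvalue {n : ℕ} {A : Matrix (Fin n) (Fin n) ℝ} (hA : A.PosSemidef) :
    Antitone (matEigenvalue A) := by
  intro i j hij
  by_cases hj : j < n
  · unfold matEigenvalue
    rw [dif_pos ⟨hA.1, hj⟩, dif_pos ⟨hA.1, hij.trans_lt hj⟩]
    exact hA.1.eigenvalues₀_antitone (Fin.mk_le_mk.mpr hij)
  · rw [matEigenvalue_of_le A (not_lt.mp hj)]
    exact matEigenvalue_nonneg hA i

theorem hasSum_matEigenvalue_pow {n : ℕ} {A : Matrix (Fin n) (Fin n) ℝ} (hA : A.IsHermitian)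
    {p : ℕ} (hp : p ≠ 0) : HasSum (fun i => matEigenvalue A i ^ p) (A ^ p).trace := by
  have h1 : HasSum (fun i => matEigenvalue A i ^ p)
      (∑ i ∈ Finset.range (Fintype.card (Fin n)), matEigenvalue A i ^ p) := by
    refine hasSum_sum_of_ne_finset_zero fun i hi => ?_
    rw [Finset.mem_range, Fintype.card_fin, not_lt] at hi
    rw [matEigenvalue_of_le A hi, zero_pow hp]
  rw [trace_pow_eq_sum_eigenvalues₀ hA]
  rw [← Fin.sum_univ_eq_sum_range (fun i => matEigenvalue A i ^ p)] at h1
  convert h1 using 3 with i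
  unfold matEigenvalue
  rw [dif_pos ⟨hA, i.2.trans_eq (Fintype.card_fin n)⟩]

/-- If the averages of the weights of the closed walks through the observation points converge to
the power sums of `lam`, then the eigenvalues of the kernel matrices, divided by the number of
points, converge to `lam`. -/
theorem tendsto_matEigenvalue {X : Type*} {k : X → X → ℝ}
    (hpsd : ∀ (n : ℕ) (x : Fin n → X), (kernelMatrix k x).PosSemidef) (hdiag : ∀ x, k x x = 1)
    {z : ∀ n, Fin n → X} {lam : ℕ → ℝ} (hl0 : ∀ i, 0 ≤ lam i) (hl : Antitone lam) {L : ℕ → ℝ}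
    (hL : ∀ q : ℕ, HasSum (fun i => lam i ^ (2 * q + 4)) (L (2 * q + 3)))
    (h : ∀ q : ℕ, Tendsto (fun n : ℕ => (1 / n : ℝ) ^ (q + 1) *
      ∑ c : Fin (q + 1) → Fin n, closedWalkWeight k q (z n ∘ c)) atTop (𝓝 (L q))) (l : ℕ) :
    Tendsto (fun n : ℕ => (1 / n : ℝ) * matEigenvalue (kernelMatrix k (z n)) l) atTop
      (𝓝 (lam l)) := by
  have hsum : ∀ n p : ℕ, p ≠ 0 → HasSum
      (fun i => ((1 / n : ℝ) * matEigenvalue (kernelMatrix k (z n)) i) ^ p)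
      ((1 / n : ℝ) ^ p * ((kernelMatrix k (z n)) ^ p).trace) := by
    intro n p hp
    simp only [mul_pow]
    exact (hasSum_matEigenvalue_pow (hpsd n (z n)).1 hp).mul_left _
  have h0 : ∀ n i : ℕ, 0 ≤ (1 / n : ℝ) * matEigenvalue (kernelMatrix k (z n)) i := fun n i =>
    mul_nonneg (by positivity) (matEigenvalue_nonneg (hpsd n _) i)
  have hanti : ∀ n : ℕ, Antitone fun i => (1 / n : ℝ) * matEigenvalue (kernelMatrix k (z n)) i :=
    fun n i j hij => mul_le_mul_of_nonneg_left (antitone_matEigenvalue (hpsd n _) hij)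
      (by positivity)
  refine tendsto_of_evenPowerSums_tendsto (f := atTop)
    (a := fun (n : ℕ) i => (1 / n : ℝ) * matEigenvalue (kernelMatrix k (z n)) i)
    (Eventually.of_forall h0) ?_ (Eventually.of_forall hanti) hl0 hl (hL 0).summable
    (fun q => ?_) l
  -- The unit diagonal makes the normalised trace `1` for `n > 0`, and the first `i + 1` entries are
  -- each at least the `i`-th.
  · filter_upwards [eventually_gt_atTop 0] with n hn i
    have h1 := hsum n 1 one_ne_zero
    have htr : (1 / n : ℝ) ^ 1 * ((kernelMatrix k (z n)) ^ 1).trace = 1 := by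
      simp only [pow_one, Matrix.trace, kernelMatrix, Matrix.diag, Matrix.of_apply, hdiag]
      simp [hn.ne']
    rw [htr] at h1
    simp only [pow_one] at h1
    have h2 := sum_le_hasSum (Finset.range (i + 1)) (fun j _ => h0 n j) h1
    have h3 := Finset.card_nsmul_le_sum (Finset.range (i + 1)) _ _ fun j hj =>
      hanti n (Nat.lt_succ_iff.mp (Finset.mem_range.mp hj))
    rw [Finset.card_range, nsmul_eq_mul] at h3
    rw [le_div_iff₀ (by positivity), mul_comm]
    push_cast at h3
    exact h3.trans h2
  · rw [(hL q).tsum_eq]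
    refine (h (2 * q + 3)).congr fun n => ?_
    rw [(hsum n (2 * q + 4) (by omega)).tsum_eq, ← sum_closedWalkWeight]
    simp only [closedWalkWeight_comp]
    rfl

/-! ### The strong law of large numbers for V-statistics -/

/-- Union bound over the pairs that may collide; a map with a prescribed collision is determined by
its values off one of the two points. -/
theorem card_not_injective_le {κ : Type*} [Fintype κ] [DecidableEq κ] (n : ℕ) :
    ((Finset.univ.filter fun d : κ → Fin n => ¬ Function.Injective d).card : ℝ) ≤
      (Fintype.card κ) ^ 2 * (n : ℝ) ^ (Fintype.card κ - 1) := by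
  have hsub : (Finset.univ.filter fun d : κ → Fin n => ¬ Function.Injective d) ⊆
      (Finset.univ.filter fun p : κ × κ => p.1 ≠ p.2).biUnion
        fun p => Finset.univ.filter fun d : κ → Fin n => d p.1 = d p.2 := by
    intro d hd
    have hd' : ¬ Function.Injective d := (Finset.mem_filter.mp hd).2
    simp only [Function.Injective] at hd'
    push Not at hd'
    obtain ⟨s, t, hst, hne⟩ := hd'
    simp only [Finset.mem_biUnion, Finset.mem_filter, Finset.mem_univ, true_and]
    exact ⟨(s, t), hne, hst⟩
  have hcard : ∀ p ∈ Finset.univ.filter fun p : κ × κ => p.1 ≠ p.2,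
      (Finset.univ.filter fun d : κ → Fin n => d p.1 = d p.2).card ≤
        n ^ (Fintype.card κ - 1) := by
    intro p hp
    have hne : p.1 ≠ p.2 := by simpa using hp
    have h1 : (Finset.univ : Finset ({x // x ≠ p.2} → Fin n)).card = n ^ (Fintype.card κ - 1) := by
      rw [Finset.card_univ, Fintype.card_fun, Fintype.card_fin, Fintype.card_subtype_compl,
        Fintype.card_subtype_eq]
    rw [← h1]
    refine Finset.card_le_card_of_injOn (fun d x => d x.1) (fun _ _ => Finset.mem_univ _) ?_
    intro d hd d' hd' h
    have hd1 : d p.1 = d p.2 := by simpa using hd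
    have hd1' : d' p.1 = d' p.2 := by simpa using hd'
    have h2 : ∀ x, x ≠ p.2 → d x = d' x := fun x hx => congrFun h ⟨x, hx⟩
    funext x
    by_cases hx : x = p.2
    · rw [hx, ← hd1, ← hd1']
      exact h2 _ hne
    · exact h2 x hx
  have h2 := (Finset.card_le_card hsub).trans (Finset.card_biUnion_le_card_mul _ _ _ hcard)
  have h3 : (Finset.univ.filter fun p : κ × κ => p.1 ≠ p.2).card ≤ Fintype.card κ ^ 2 := by
    refine (Finset.card_filter_le _ _).trans_eq ?_
    rw [Finset.card_univ, Fintype.card_prod, sq]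
  exact_mod_cast h2.trans (Nat.mul_le_mul_right _ h3)

theorem abs_sum_fin_sub_le {ι : Type*} [Fintype ι] [DecidableEq ι] {F : (ι → ℕ) → ℝ}
    (hF : ∀ c, |F c| ≤ 1) {m n : ℕ} (hmn : m ≤ n) :
    |∑ c : ι → Fin n, F (fun i => c i) - ∑ c : ι → Fin m, F (fun i => c i)| ≤
      (n : ℝ) ^ Fintype.card ι - (m : ℝ) ^ Fintype.card ι := by
  let e : (ι → Fin m) ↪ (ι → Fin n) :=
    ⟨fun c i => Fin.castLE hmn (c i), fun c c' h => funext fun i =>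
      Fin.castLE_injective hmn (congrFun h i)⟩
  have h1 : ∑ c : ι → Fin m, F (fun i => c i) =
      ∑ c ∈ Finset.univ.map e, F (fun i => c i) := by
    rw [Finset.sum_map]; rfl
  rw [h1, ← Finset.sum_sdiff (Finset.subset_univ (Finset.univ.map e)), add_sub_cancel_right]
  refine (Finset.abs_sum_le_sum_abs _ _).trans ((Finset.sum_le_sum fun c _ => hF _).trans_eq ?_)
  rw [Finset.sum_const, nsmul_eq_mul, mul_one, Finset.cast_card_sdiff (Finset.subset_univ _),
    Finset.card_map]
  simp

/-- A V-statistic of a bounded kernel converges if it converges along the squares. -/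
theorem tendsto_vStatistic_of_squares {ι : Type*} [Fintype ι] [DecidableEq ι] {F : (ι → ℕ) → ℝ}
    (hF : ∀ c, |F c| ≤ 1) {θ : ℝ}
    (h : Tendsto (fun m : ℕ => (1 / (m ^ 2 : ℕ) : ℝ) ^ Fintype.card ι *
      ∑ c : ι → Fin (m ^ 2), F (fun i => c i)) atTop (𝓝 θ)) :
    Tendsto (fun n : ℕ => (1 / n : ℝ) ^ Fintype.card ι * ∑ c : ι → Fin n, F (fun i => c i))
      atTop (𝓝 θ) := by
  set r := Fintype.card ι
  set V : ℕ → ℝ := fun n => (1 / n : ℝ) ^ r * ∑ c : ι → Fin n, F (fun i => c i) with hV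
  -- The ratio of the largest square below `n` to `n`, which tends to `1`. Passing from that square
  -- to `n` adds only a proportion `1 - ρ n ^ r` of tuples.
  let ρ : ℕ → ℝ := fun n => ((Nat.sqrt n ^ 2 : ℕ) : ℝ) / n
  have hsqrt : Tendsto Nat.sqrt atTop atTop := by
    refine tendsto_atTop.mpr fun b => ?_
    filter_upwards [eventually_ge_atTop (b ^ 2)] with n hn
    exact Nat.le_sqrt'.mpr hn
  have hρ1 : ∀ n, ρ n ≤ 1 := fun n => by
    refine div_le_one_of_le₀ ?_ (Nat.cast_nonneg n)
    exact_mod_cast Nat.sqrt_le' n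
  have hρ : Tendsto ρ atTop (𝓝 1) := by
    have hlow : Tendsto (fun n : ℕ => ((Nat.sqrt n : ℝ) / (Nat.sqrt n + 1)) ^ 2) atTop
        (𝓝 (1 ^ 2)) := ((tendsto_natCast_div_add_atTop (1 : ℝ)).comp hsqrt).pow 2
    rw [one_pow] at hlow
    refine tendsto_of_tendsto_of_tendsto_of_le_of_le' hlow tendsto_const_nhds ?_
      (Eventually.of_forall hρ1)
    filter_upwards [eventually_gt_atTop 0] with n hn
    rw [div_pow]
    simp only [ρ]
    push_cast
    have h1 : (n : ℝ) ≤ ((Nat.sqrt n : ℝ) + 1) ^ 2 := by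
      exact_mod_cast (Nat.lt_succ_sqrt' n).le
    have h2 : (0 : ℝ) < n := by exact_mod_cast hn
    gcongr
  have h1 : Tendsto (fun n => ρ n ^ r * V (Nat.sqrt n ^ 2)) atTop (𝓝 (1 ^ r * θ)) :=
    (hρ.pow r).mul (h.comp hsqrt)
  rw [one_pow, one_mul] at h1
  have h2 : Tendsto (fun n => V n - ρ n ^ r * V (Nat.sqrt n ^ 2)) atTop (𝓝 0) := by
    have h3 : Tendsto (fun n => 1 - ρ n ^ r) atTop (𝓝 (1 - 1 ^ r)) := (hρ.pow r).const_sub 1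
    rw [one_pow, sub_self] at h3
    refine squeeze_zero_norm' ?_ h3
    filter_upwards [eventually_gt_atTop 0] with n hn
    have hn' : (0 : ℝ) < n := by exact_mod_cast hn
    have hs' : (0 : ℝ) < (Nat.sqrt n ^ 2 : ℕ) := by
      exact_mod_cast pow_pos (Nat.sqrt_pos.mpr hn) 2
    have h4 := abs_sum_fin_sub_le hF (Nat.sqrt_le' n)
    have h5 : V n - ρ n ^ r * V (Nat.sqrt n ^ 2) = (1 / n : ℝ) ^ r *
        (∑ c : ι → Fin n, F (fun i => c i) -
          ∑ c : ι → Fin (Nat.sqrt n ^ 2), F (fun i => c i)) := by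
      simp only [hV, ρ]
      rw [← mul_assoc, ← mul_pow, mul_sub]
      congr 3
      field_simp
    rw [h5, Real.norm_eq_abs, abs_mul, abs_of_nonneg (by positivity)]
    calc (1 / n : ℝ) ^ r * _ ≤ (1 / n : ℝ) ^ r * ((n : ℝ) ^ r - ((Nat.sqrt n ^ 2 : ℕ) : ℝ) ^ r) :=
          mul_le_mul_of_nonneg_left h4 (by positivity)
      _ = 1 - ρ n ^ r := by
          simp only [ρ]
          rw [mul_sub, ← mul_pow, ← mul_pow, one_div_mul_cancel hn'.ne', one_pow,
            one_div_mul_eq_div]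
  have h3 := h2.add h1
  rw [zero_add] at h3
  exact h3.congr fun n => by ring

section Iid

variable {E Ω : Type*} [MeasurableSpace E] [MeasurableSpace Ω] {P : Measure Ω}
  {ν : Measure E} {Z : ℕ → Ω → E}
  {ι : Type*} [Fintype ι] [DecidableEq ι]

omit [DecidableEq ι] in
theorem map_iid_injective (hZ : ∀ m, Measurable (Z m)) (hind : iIndepFun Z P)
    (hlaw : ∀ m, P.map (Z m) = ν) {d : ι → ℕ} (hd : Function.Injective d) :
    P.map (fun ω i => Z (d i) ω) = Measure.pi fun _ => ν := by
  have h := (hind.precomp hd).map_fun_eq_pi_map fun i => (hZ (d i)).aemeasurable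
  simpa only [Function.comp_apply, hlaw] using h

variable [IsProbabilityMeasure ν]

omit [DecidableEq ι] in
theorem integral_pi_sum_mul (f g : (ι → E) → ℝ) :
    ∫ y : ι ⊕ ι → E, f (fun i => y (Sum.inl i)) * g (fun i => y (Sum.inr i))
      ∂(Measure.pi fun _ => ν) =
      (∫ y, f y ∂(Measure.pi fun _ => ν)) * ∫ y, g y ∂(Measure.pi fun _ => ν) := by
  rw [← integral_prod_mul]
  have h := measurePreserving_sumPiEquivProdPi fun _ : ι ⊕ ι => ν
  exact h.integral_comp' (g := fun p : (ι → E) × (ι → E) => f p.1 * g p.2)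

variable [IsProbabilityMeasure P]

/-- The square is a sum over maps `ι ⊕ ι → Fin n`. For an injective map the two factors are
independent and centred, so the term vanishes. At most `(2r)² n ^ (2r-1)` maps remain, each
contributing at most `4`. -/
theorem integral_sq_vStatistic_le (hZ : ∀ m, Measurable (Z m)) (hind : iIndepFun Z P)
    (hlaw : ∀ m, P.map (Z m) = ν) {g : (ι → E) → ℝ} (hg : Measurable g) (hg2 : ∀ y, |g y| ≤ 2)
    (hg0 : ∫ y, g y ∂(Measure.pi fun _ => ν) = 0) {n : ℕ} (hn : 0 < n) :
    ∫ ω, ((1 / n : ℝ) ^ Fintype.card ι *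
      ∑ c : ι → Fin n, g (fun i => Z (c i) ω)) ^ 2 ∂P ≤ 16 * (Fintype.card ι : ℝ) ^ 2 / n := by
  have hn' : (0 : ℝ) < n := by exact_mod_cast hn
  -- For `r = 0` the truncated exponent `2 * r - 1` would spoil the count; here `g` is a constant
  -- with integral `0`.
  rcases Nat.eq_zero_or_pos (Fintype.card ι) with h0 | hpos
  · have hempty : IsEmpty ι := Fintype.card_eq_zero_iff.mp h0
    have h1 : ∀ ω, ∑ c : ι → Fin n, g (fun i => Z (c i) ω) = 0 := by
      intro ω
      refine Finset.sum_eq_zero fun c _ => ?_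
      rw [← hg0]
      have : ∀ y, g y = g (fun i => Z (c i) ω) := fun y => congrArg g (Subsingleton.elim _ _)
      simp [this]
    simp only [h1]
    simp
  set r := Fintype.card ι
  let G : (ι ⊕ ι → Fin n) → Ω → ℝ := fun d ω =>
    g (fun i => Z (d (Sum.inl i)) ω) * g (fun i => Z (d (Sum.inr i)) ω)
  have hsq : ∀ ω, ((1 / n : ℝ) ^ r * ∑ c : ι → Fin n, g (fun i => Z (c i) ω)) ^ 2 =
      (1 / n : ℝ) ^ (2 * r) * ∑ d, G d ω := by
    intro ω
    rw [mul_pow, ← pow_mul, mul_comm r 2, sq (∑ c : ι → Fin n, _), Finset.sum_mul_sum,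
      ← Fintype.sum_prod_type', ← (Equiv.sumArrowEquivProdArrow ι ι (Fin n)).sum_comp]
    rfl
  have hGm : ∀ d, Measurable (G d) := fun d =>
    (hg.comp (measurable_pi_lambda _ fun i => hZ _)).mul
      (hg.comp (measurable_pi_lambda _ fun i => hZ _))
  have hG4 : ∀ d ω, |G d ω| ≤ 4 := fun d ω => by
    simp only [G]
    rw [abs_mul]
    calc _ ≤ (2 : ℝ) * 2 := mul_le_mul (hg2 _) (hg2 _) (abs_nonneg _) (by norm_num)
      _ = 4 := by norm_num
  have hGi : ∀ d, Integrable (G d) P := fun d =>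
    Integrable.of_bound (hGm d).aestronglyMeasurable 4 (ae_of_all _ (hG4 d))
  have hzero : ∀ d, Function.Injective d → ∫ ω, G d ω ∂P = 0 := by
    intro d hd
    have h1 := map_iid_injective hZ hind hlaw (d := fun i => (d i : ℕ)) (Fin.val_injective.comp hd)
    have h2 := integral_pi_sum_mul (ν := ν) g g
    rw [hg0, zero_mul, ← h1, integral_map] at h2
    · exact h2
    · exact (measurable_pi_lambda _ fun i => hZ _).aemeasurable
    · exact ((hg.comp (measurable_pi_lambda _ fun i => measurable_pi_apply _)).mul
        (hg.comp (measurable_pi_lambda _ fun i => measurable_pi_apply _))).aestronglyMeasurable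
  have hle4 : ∀ d, ∫ ω, G d ω ∂P ≤ 4 := fun d => by
    calc ∫ ω, G d ω ∂P ≤ ∫ _, (4 : ℝ) ∂P :=
          integral_mono (hGi d) (integrable_const _) fun ω => (abs_le.mp (hG4 d ω)).2
      _ = 4 := by simp
  have hsum : ∑ d, ∫ ω, G d ω ∂P ≤ 4 * ((2 * r : ℝ) ^ 2 * (n : ℝ) ^ (2 * r - 1)) := by
    rw [← Finset.sum_filter_add_sum_filter_not Finset.univ
      (fun d : ι ⊕ ι → Fin n => Function.Injective d)]
    rw [Finset.sum_eq_zero fun d hd => hzero d (Finset.mem_filter.mp hd).2, zero_add]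
    refine (Finset.sum_le_card_nsmul _ _ 4 fun d _ => hle4 d).trans ?_
    rw [nsmul_eq_mul, mul_comm]
    refine mul_le_mul_of_nonneg_left ?_ (by norm_num)
    have h1 := card_not_injective_le (κ := ι ⊕ ι) n
    have h2 : Fintype.card (ι ⊕ ι) = 2 * r := by rw [Fintype.card_sum, two_mul]
    rw [h2] at h1
    push_cast at h1
    exact h1
  simp only [hsq]
  rw [integral_const_mul, integral_finsetSum _ fun d _ => hGi d]
  calc (1 / n : ℝ) ^ (2 * r) * ∑ d, ∫ ω, G d ω ∂P
      ≤ (1 / n : ℝ) ^ (2 * r) * (4 * ((2 * r : ℝ) ^ 2 * (n : ℝ) ^ (2 * r - 1))) :=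
        mul_le_mul_of_nonneg_left hsum (by positivity)
    _ = 16 * (r : ℝ) ^ 2 / n := by
        have h1 : (n : ℝ) ^ (2 * r) = (n : ℝ) ^ (2 * r - 1) * n := by
          rw [← pow_succ]; congr 1; omega
        rw [one_div, inv_pow, h1]
        field_simp
        ring

/-- The strong law of large numbers for V-statistics of a bounded kernel. -/
theorem ae_tendsto_vStatistic (hZ : ∀ m, Measurable (Z m)) (hind : iIndepFun Z P)
    (hlaw : ∀ m, P.map (Z m) = ν) {h : (ι → E) → ℝ} (hh : Measurable h) (hh1 : ∀ y, |h y| ≤ 1) :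
    ∀ᵐ ω ∂P, Tendsto (fun n : ℕ => (1 / n : ℝ) ^ Fintype.card ι *
      ∑ c : ι → Fin n, h (fun i => Z (c i) ω)) atTop (𝓝 (∫ y, h y ∂(Measure.pi fun _ => ν))) := by
  set θ := ∫ y, h y ∂(Measure.pi fun _ => ν)
  have hθ : |θ| ≤ 1 := by
    have := norm_integral_le_of_norm_le_const (μ := Measure.pi fun _ : ι => ν) (C := 1)
      (f := h) (ae_of_all _ hh1)
    simpa using this
  let g : (ι → E) → ℝ := fun y => h y - θ
  have hg : Measurable g := hh.sub_const θ
  have hg2 : ∀ y, |g y| ≤ 2 := fun y => by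
    have := (abs_sub (h y) θ).trans (add_le_add (hh1 y) hθ)
    norm_num at this
    exact this
  have hg0 : ∫ y, g y ∂(Measure.pi fun _ => ν) = 0 := by
    simp only [g]
    rw [integral_sub (integrable_of_abs_le_one hh hh1) (integrable_const _)]
    simp [θ]
  let W : ℕ → Ω → ℝ := fun n ω =>
    (1 / n : ℝ) ^ Fintype.card ι * ∑ c : ι → Fin n, g (fun i => Z (c i) ω)
  have hWm : ∀ n, Measurable (W n) := fun n =>
    (Finset.measurable_sum _ fun c _ =>
      hg.comp (measurable_pi_lambda _ fun i => hZ _)).const_mul _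
  have hWb : ∀ n ω, |W n ω| ≤ (1 / n : ℝ) ^ Fintype.card ι * (Fintype.card (ι → Fin n) * 2) := by
    intro n ω
    simp only [W]
    rw [abs_mul, abs_of_nonneg (by positivity)]
    refine mul_le_mul_of_nonneg_left ?_ (by positivity)
    refine (Finset.abs_sum_le_sum_abs _ _).trans ((Finset.sum_le_sum fun c _ => hg2 _).trans_eq ?_)
    simp
  have hWi : ∀ n, Integrable (fun ω => W n ω ^ 2) P := fun n =>
    (MemLp.of_bound (hWm n).aestronglyMeasurable _ (ae_of_all _ (hWb n))).integrable_sq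
  set C : ℝ := 16 * (Fintype.card ι : ℝ) ^ 2
  have hbound : ∀ m : ℕ, ∫ ω, W ((m + 1) ^ 2) ω ^ 2 ∂P ≤ C * (1 / (m + 1)) ^ 2 := by
    intro m
    refine (integral_sq_vStatistic_le hZ hind hlaw hg hg2 hg0
      (pow_pos m.succ_pos 2)).trans_eq ?_
    push_cast
    field_simp
    rfl
  -- Along the squares the second moments are `O(1 / (m + 1) ^ 2)`, so the sum of the squared
  -- deviations is integrable and almost surely finite; its terms then tend to `0`.
  have hfin : ∫⁻ ω, ∑' m : ℕ, ENNReal.ofReal (W ((m + 1) ^ 2) ω ^ 2) ∂P ≠ ⊤ := by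
    rw [lintegral_tsum fun m => ((hWm _).pow_const 2).ennreal_ofReal.aemeasurable]
    have h1 : ∀ m : ℕ, ∫⁻ ω, ENNReal.ofReal (W ((m + 1) ^ 2) ω ^ 2) ∂P ≤
        ENNReal.ofReal (C * (1 / (m + 1)) ^ 2) := fun m => by
      rw [← ofReal_integral_eq_lintegral_ofReal (hWi _) (ae_of_all _ fun ω => sq_nonneg _)]
      exact ENNReal.ofReal_le_ofReal (hbound m)
    refine ne_top_of_le_ne_top ?_ (ENNReal.tsum_le_tsum h1)
    exact ((summable_inv_succ_pow (le_refl 2)).mul_left C).tsum_ofReal_ne_top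
  have hae := ae_lt_top' (AEMeasurable.tsum fun m =>
    ((hWm ((m + 1) ^ 2)).pow_const 2).ennreal_ofReal.aemeasurable) hfin
  filter_upwards [hae] with ω hω
  refine tendsto_vStatistic_of_squares (F := fun c => h (fun i => Z (c i) ω)) (fun c => hh1 _) ?_
  have h1 := ENNReal.tendsto_atTop_zero_of_tsum_ne_top hω.ne
  have h2 : Tendsto (fun m : ℕ => W ((m + 1) ^ 2) ω ^ 2) atTop (𝓝 0) := by
    have := (ENNReal.tendsto_toReal ENNReal.zero_ne_top).comp h1
    refine this.congr fun m => ?_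
    exact ENNReal.toReal_ofReal (sq_nonneg _)
  have h3 : Tendsto (fun m : ℕ => W ((m + 1) ^ 2) ω) atTop (𝓝 0) := by
    have h4 := h2.sqrt
    simp only [Real.sqrt_zero, Real.sqrt_sq_eq_abs] at h4
    exact (tendsto_zero_iff_abs_tendsto_zero _).mpr h4
  rw [← tendsto_add_atTop_iff_nat 1]
  have h5 := h3.add_const θ
  rw [zero_add] at h5
  refine h5.congr fun m => ?_
  simp only [W, g]
  have hm : (0 : ℝ) < ((m + 1) ^ 2 : ℕ) := by positivity
  rw [Finset.sum_sub_distrib, mul_sub, sub_add_eq_add_sub, sub_eq_iff_eq_add]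
  congr 1
  rw [Finset.sum_const, Finset.card_univ, Fintype.card_fun, Fintype.card_fin, nsmul_eq_mul,
    Nat.cast_pow ((m + 1) ^ 2), ← mul_assoc, ← mul_pow, one_div_mul_cancel hm.ne', one_pow, one_mul]

end Iid

/-! ### V-statistics of weakly convergent point sets -/

theorem toReal_uniformOn_univ_singleton {n : ℕ} (a : Fin n) :
    (uniformOn (Set.univ : Set (Fin n)) {a}).toReal = 1 / n := by
  rw [uniformOn_univ]
  simp

/-- A V-statistic is the integral of its kernel against a power of the empirical measure, which is
the image of the uniform measure on the indices. -/
theorem integral_pi_map_uniformOn {E ι : Type*} [MeasurableSpace E] [Fintype ι] [DecidableEq ι]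
    {n : ℕ} (hn : 0 < n) (y : Fin n → E) {h : (ι → E) → ℝ} (hh : Measurable h) :
    ∫ e, h e ∂(Measure.pi fun _ => (uniformOn (Set.univ : Set (Fin n))).map y) =
      (1 / n : ℝ) ^ Fintype.card ι * ∑ c : ι → Fin n, h (fun i => y (c i)) := by
  have hne : Nonempty (Fin n) := ⟨⟨0, hn⟩⟩
  have hU : IsProbabilityMeasure (uniformOn (Set.univ : Set (Fin n))) :=
    isProbabilityMeasure_uniformOn Set.finite_univ Set.univ_nonempty
  have hy : Measurable y := measurable_of_countable y
  have hyi : Measurable fun (c : ι → Fin n) i => y (c i) :=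
    measurable_pi_lambda _ fun i => hy.comp (measurable_pi_apply i)
  have hprob : IsProbabilityMeasure ((uniformOn (Set.univ : Set (Fin n))).map y) :=
    Measure.isProbabilityMeasure_map hy.aemeasurable
  rw [← Measure.pi_map_pi fun _ => hy.aemeasurable,
    integral_map hyi.aemeasurable hh.aestronglyMeasurable,
    integral_fintype Integrable.of_finite, Finset.mul_sum]
  refine Finset.sum_congr rfl fun c _ => ?_
  rw [smul_eq_mul]
  congr 1
  rw [measureReal_def, Measure.pi_singleton, ENNReal.toReal_prod]
  simp [toReal_uniformOn_univ_singleton]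

/-- Weak convergence of the empirical measures passes to finite powers. The shift to `n + 1` avoids
the empty dataset, which has no empirical probability measure. -/
theorem tendsto_vStatistic_of_tendsto {E ι : Type*} [TopologicalSpace E]
    [SecondCountableTopology E] [TopologicalSpace.PseudoMetrizableSpace E] [MeasurableSpace E]
    [BorelSpace E] [Fintype ι] [DecidableEq ι] {ν : Measure E} [IsProbabilityMeasure ν]
    {y : ∀ n, Fin n → E}
    (hy : ∀ f : BoundedContinuousFunction E ℝ,
      Tendsto (fun n : ℕ => (1 / n : ℝ) * ∑ a : Fin n, f (y n a)) atTop (𝓝 (∫ e, f e ∂ν)))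
    {h : (ι → E) → ℝ} (hh : Continuous h) (hh1 : ∀ e, |h e| ≤ 1) :
    Tendsto (fun n : ℕ => (1 / n : ℝ) ^ Fintype.card ι *
      ∑ c : ι → Fin n, h (fun i => y n (c i))) atTop
      (𝓝 (∫ e, h e ∂(Measure.pi fun _ => ν))) := by
  have hprob : ∀ n : ℕ, IsProbabilityMeasure
      ((uniformOn (Set.univ : Set (Fin (n + 1)))).map (y (n + 1))) := fun n =>
    have : IsProbabilityMeasure (uniformOn (Set.univ : Set (Fin (n + 1)))) :=
      isProbabilityMeasure_uniformOn Set.finite_univ Set.univ_nonempty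
    Measure.isProbabilityMeasure_map (measurable_of_countable _).aemeasurable
  let νs : ℕ → ProbabilityMeasure E := fun n => ⟨_, hprob n⟩
  let ν' : ProbabilityMeasure E := ⟨ν, inferInstance⟩
  have hconv : Tendsto νs atTop (𝓝 ν') := by
    rw [ProbabilityMeasure.tendsto_iff_forall_integral_tendsto]
    intro f
    refine ((tendsto_add_atTop_iff_nat 1).mpr (hy f)).congr fun n => ?_
    change _ = ∫ e, f e ∂((uniformOn (Set.univ : Set (Fin (n + 1)))).map (y (n + 1)))
    have : IsProbabilityMeasure (uniformOn (Set.univ : Set (Fin (n + 1)))) :=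
      isProbabilityMeasure_uniformOn Set.finite_univ Set.univ_nonempty
    rw [integral_map (measurable_of_countable _).aemeasurable
      f.continuous.measurable.aestronglyMeasurable, integral_fintype Integrable.of_finite,
      Finset.mul_sum]
    refine Finset.sum_congr rfl fun a _ => ?_
    rw [smul_eq_mul, measureReal_def, toReal_uniformOn_univ_singleton]
  have hpi : Tendsto (fun n => ProbabilityMeasure.pi fun _ : ι => νs n) atTop
      (𝓝 (ProbabilityMeasure.pi fun _ : ι => ν')) :=
    (ProbabilityMeasure.continuous_pi.tendsto _).comp (tendsto_pi_nhds.mpr fun _ => hconv)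
  rw [ProbabilityMeasure.tendsto_iff_forall_integral_tendsto] at hpi
  have h1 := hpi (BoundedContinuousFunction.ofNormedAddCommGroup h hh 1 hh1)
  refine (tendsto_add_atTop_iff_nat 1).mp (h1.congr fun n => ?_)
  exact integral_pi_map_uniformOn n.succ_pos (y (n + 1)) hh.measurable

/-! ### The pseudometric of a continuous correlation function -/

section KernelSpace

variable {X : Type*} [MeasurableSpace X] {k : X → X → ℝ}

/-- With `δ = k x y - k x' y`, the quadratic form at `x, x', y` with coefficients `1, -1, -δ` equals
`2 * (1 - k x x') - δ ^ 2`. The bound is uniform in `y`, so sections depend continuously on `x` in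
the supremum norm without compactness. -/
theorem IsCorrelation.sq_sub_le (hk : IsCorrelation k) (x x' y : X) :
    (k x y - k x' y) ^ 2 ≤ 2 * (1 - k x x') := by
  have h := (hk.posSemidef 3 ![x, x', y]).dotProduct_mulVec_nonneg
    ![1, -1, -(k x y - k x' y)]
  simp [Matrix.mulVec, dotProduct, Fin.sum_univ_three, hk.diag] at h
  rw [hk.symm x' x, hk.symm y x, hk.symm y x'] at h
  nlinarith

variable [TopologicalSpace X]

/-- The function `k x` as a bounded continuous function. -/
def kernelSection (hk : IsCorrelation k) (hc : Continuous (Function.uncurry k)) (x : X) :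
    BoundedContinuousFunction X ℝ :=
  BoundedContinuousFunction.ofNormedAddCommGroup (k x) (hc.comp (Continuous.prodMk_right x)) 1
    fun y => hk.abs_le_one x y

theorem continuous_kernelSection (hk : IsCorrelation k) (hc : Continuous (Function.uncurry k)) :
    Continuous (kernelSection hk hc) := by
  rw [continuous_iff_continuousAt]
  intro x
  rw [ContinuousAt, tendsto_iff_dist_tendsto_zero]
  have h1 : Tendsto (fun x' => Real.sqrt (2 * (1 - k x' x))) (𝓝 x) (𝓝 0) := by
    have h2 : Continuous fun x' => Real.sqrt (2 * (1 - k x' x)) :=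
      ((continuous_const.sub (hc.comp (Continuous.prodMk_left x))).const_mul 2).sqrt
    have h3 := h2.tendsto x
    simpa [hk.diag] using h3
  refine squeeze_zero (fun _ => dist_nonneg) (fun x' => ?_) h1
  rw [BoundedContinuousFunction.dist_le (Real.sqrt_nonneg _)]
  intro y
  exact Real.abs_le_sqrt (hk.sq_sub_le x' x y)

/-- The space `X` with the pseudometric under which `x` and `x'` are as far apart as the functions
`k x` and `k x'` in the supremum norm. -/
def KernelSpace (_hk : IsCorrelation k) (_hc : Continuous (Function.uncurry k)) : Type _ := X

variable (hk : IsCorrelation k) (hc : Continuous (Function.uncurry k))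

/-- The identity map from `KernelSpace` to `X`. -/
def ofKernelSpace (x : KernelSpace hk hc) : X := x

/-- This topology is coarser than that of `X`, and its continuous functions cannot separate points
with equal sections. They are therefore admissible in `HasLimitDistribution`, while `k` itself stays
continuous. -/
noncomputable instance : PseudoMetricSpace (KernelSpace hk hc) :=
  PseudoMetricSpace.induced (fun x => kernelSection hk hc (ofKernelSpace hk hc x)) inferInstance

/-- The identity map from `X` to `KernelSpace`. -/
def toKernelSpace (x : X) : KernelSpace hk hc := x

/-- The kernel `k` on `KernelSpace`. -/
def kernelOnSpace (x y : KernelSpace hk hc) : ℝ :=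
  k (ofKernelSpace hk hc x) (ofKernelSpace hk hc y)

noncomputable instance : MeasurableSpace (KernelSpace hk hc) := borel _

instance : BorelSpace (KernelSpace hk hc) := ⟨rfl⟩

theorem continuous_toKernelSpace : Continuous (toKernelSpace hk hc) :=
  continuous_induced_rng.mpr (continuous_kernelSection hk hc)

/-- A continuous image of a separable space is separable, and a separable pseudometric space is
second countable. -/
instance [SecondCountableTopology X] : SecondCountableTopology (KernelSpace hk hc) := by
  have hsurj : Function.Surjective (toKernelSpace hk hc) := fun x => ⟨x, rfl⟩
  have := hsurj.denseRange.separableSpace (continuous_toKernelSpace hk hc)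
  exact UniformSpace.secondCountable_of_separable _

theorem abs_kernelOnSpace_sub_le (x x' y : KernelSpace hk hc) :
    |kernelOnSpace hk hc x y - kernelOnSpace hk hc x' y| ≤ dist x x' :=
  BoundedContinuousFunction.dist_coe_le_dist (f := kernelSection hk hc (ofKernelSpace hk hc x))
    (g := kernelSection hk hc (ofKernelSpace hk hc x')) (ofKernelSpace hk hc y)

theorem continuous_kernelOnSpace : Continuous (Function.uncurry (kernelOnSpace hk hc)) := by
  have h : LipschitzWith 2 (Function.uncurry (kernelOnSpace hk hc)) := by
    refine LipschitzWith.of_dist_le_mul fun p q => ?_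
    have hs : ∀ x y, kernelOnSpace hk hc x y = kernelOnSpace hk hc y x := fun x y =>
      hk.symm _ _
    have h1 := abs_kernelOnSpace_sub_le hk hc p.1 q.1 p.2
    have h2 := abs_kernelOnSpace_sub_le hk hc p.2 q.2 q.1
    rw [hs p.2, hs q.2] at h2
    have h3 := abs_sub_le (kernelOnSpace hk hc p.1 p.2) (kernelOnSpace hk hc q.1 p.2)
      (kernelOnSpace hk hc q.1 q.2)
    have h4 : dist p.1 q.1 ≤ dist p q := le_max_left _ _
    have h5 : dist p.2 q.2 ≤ dist p q := le_max_right _ _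
    simp only [Function.uncurry, Real.dist_eq, NNReal.coe_ofNat]
    linarith
  exact h.continuous

theorem inseparable_toKernelSpace {x x' : X} (h : ∀ y, k x y = k x' y) :
    Inseparable (toKernelSpace hk hc x) (toKernelSpace hk hc x') := by
  rw [Metric.inseparable_iff]
  change dist (kernelSection hk hc x) (kernelSection hk hc x') = 0
  rw [dist_eq_zero]
  ext y
  exact h y

end KernelSpace

/-- Datasets with limit distribution `ν`, as far as two continuous correlation functions see it:
the averages of the closed walk weights of a kernel that is continuous in the pseudometrics of the
two correlation functions converge to the traces of the iterated kernels. -/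
theorem HasLimitDistribution.tendsto_closedWalkWeight {S T : Type*} [TopologicalSpace S]
    [TopologicalSpace T] [SecondCountableTopology S] [SecondCountableTopology T]
    [MeasurableSpace S] [MeasurableSpace T] [BorelSpace S] [BorelSpace T]
    {kS : S → S → ℝ} {kT : T → T → ℝ} (hkS : IsCorrelation kS) (hkT : IsCorrelation kT)
    (hcS : Continuous (Function.uncurry kS)) (hcT : Continuous (Function.uncurry kT))
    {z : ∀ n, Fin n → S × T} {ν : Measure (S × T)} [IsProbabilityMeasure ν]
    (hz : HasLimitDistribution kS kT z ν)
    {K : KernelSpace hkS hcS × KernelSpace hkT hcT → KernelSpace hkS hcS × KernelSpace hkT hcT → ℝ}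
    (hK : Continuous (Function.uncurry K)) (hK1 : ∀ p q, |K p q| ≤ 1) (q : ℕ) :
    Tendsto (fun n : ℕ => (1 / n : ℝ) ^ (q + 1) * ∑ c : Fin (q + 1) → Fin n,
      closedWalkWeight (fun p p' => K (toKernelSpace hkS hcS p.1, toKernelSpace hkT hcT p.2)
        (toKernelSpace hkS hcS p'.1, toKernelSpace hkT hcT p'.2)) q (z n ∘ c)) atTop
      (𝓝 (kernelTrace (fun p p' => K (toKernelSpace hkS hcS p.1, toKernelSpace hkT hcT p.2)
        (toKernelSpace hkS hcS p'.1, toKernelSpace hkT hcT p'.2)) ν q)) := by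
  let φ : S × T → KernelSpace hkS hcS × KernelSpace hkT hcT :=
    fun p => (toKernelSpace hkS hcS p.1, toKernelSpace hkT hcT p.2)
  have hφc : Continuous φ := ((continuous_toKernelSpace hkS hcS).comp continuous_fst).prodMk
    ((continuous_toKernelSpace hkT hcT).comp continuous_snd)
  have hφ : Measurable φ := hφc.measurable
  have hprob : IsProbabilityMeasure (ν.map φ) := Measure.isProbabilityMeasure_map hφ.aemeasurable
  have hy : ∀ f : BoundedContinuousFunction (KernelSpace hkS hcS × KernelSpace hkT hcT) ℝ,
      Tendsto (fun n : ℕ => (1 / n : ℝ) * ∑ a : Fin n, f (φ (z n a))) atTop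
        (𝓝 (∫ e, f e ∂(ν.map φ))) := by
    intro f
    rw [integral_map hφ.aemeasurable f.continuous.measurable.aestronglyMeasurable]
    -- Points with equal sections are inseparable in the kernel spaces, so `f ∘ φ` has the
    -- invariance that the hypothesis demands.
    refine hz (f.compContinuous ⟨φ, hφc⟩) fun x x' t t' hx ht => ?_
    exact (((inseparable_toKernelSpace hkS hcS hx).prod
      (inseparable_toKernelSpace hkT hcT ht)).map f.continuous).eq
  have h := tendsto_vStatistic_of_tendsto (y := fun n a => φ (z n a)) hy
    (continuous_closedWalkWeight hK q)
    (fun e => abs_walkWeight_le_one hK1 q (e 0) (e 0) (Fin.tail e))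
  rw [integral_closedWalkWeight hK.measurable hK1, ← kernelTrace_comp hφ hK.measurable ν q,
    Fintype.card_fin] at h
  refine h.congr fun n => ?_
  exact congrArg _ (Finset.sum_congr rfl fun c _ => closedWalkWeight_comp K φ q (z n ∘ c))

/-! ### Factorization of the spectrum -/

theorem posSemidef_kernelMatrix_comp {X Y : Type*} [MeasurableSpace X] {k : X → X → ℝ}
    (hk : IsCorrelation k) (φ : Y → X) (n : ℕ) (y : Fin n → Y) :
    (kernelMatrix (fun p q => k (φ p) (φ q)) y).PosSemidef :=
  hk.posSemidef n fun a => φ (y a)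

/-- Schur product theorem: the entrywise product is the submatrix of the Kronecker product on the
index pairs `(a, a)`. -/
theorem posSemidef_kernelMatrix_separable {S T : Type*} [MeasurableSpace S] [MeasurableSpace T]
    {kS : S → S → ℝ} {kT : T → T → ℝ} (hkS : IsCorrelation kS) (hkT : IsCorrelation kT) (n : ℕ)
    (z : Fin n → S × T) : (kernelMatrix (separableKernel kS kT) z).PosSemidef :=
  ((hkS.posSemidef n fun a => (z a).1).kronecker (hkT.posSemidef n fun a => (z a).2)).submatrix
    fun a => (a, a)

theorem measurable_separableKernel {S T : Type*} [MeasurableSpace S]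
    [MeasurableSpace T] {kS : S → S → ℝ} {kT : T → T → ℝ}
    (hkS : Measurable (Function.uncurry kS)) (hkT : Measurable (Function.uncurry kT)) :
    Measurable (Function.uncurry (separableKernel kS kT)) :=
  (hkS.comp (measurable_fst.fst.prodMk measurable_snd.fst)).mul
    (hkT.comp (measurable_fst.snd.prodMk measurable_snd.snd))

theorem abs_separableKernel_le_one {S T : Type*} {kS : S → S → ℝ} {kT : T → T → ℝ}
    (hkS : ∀ x y, |kS x y| ≤ 1) (hkT : ∀ x y, |kT x y| ≤ 1) (p q : S × T) :
    |separableKernel kS kT p q| ≤ 1 := by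
  rw [separableKernel, abs_mul]
  exact mul_le_one₀ (hkS _ _) (abs_nonneg _) (hkT _ _)

section Products

variable {a b : ℕ → ℝ}

theorem hasSum_mul_pow (ha0 : ∀ i, 0 ≤ a i) (hb0 : ∀ i, 0 ≤ b i) {m : ℕ} {x y : ℝ}
    (ha : HasSum (fun i => a i ^ m) x) (hb : HasSum (fun i => b i ^ m) y) :
    HasSum (fun p : ℕ × ℕ => (a p.1 * b p.2) ^ m) (x * y) := by
  simp only [mul_pow]
  exact ha.mul hb (ha.summable.mul_of_nonneg hb.summable (fun i => pow_nonneg (ha0 i) m)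
    fun i => pow_nonneg (hb0 i) m)

theorem exists_isDescendingOrdering (ha0 : ∀ i, 0 ≤ a i) (hb0 : ∀ i, 0 ≤ b i) {m : ℕ}
    (hm : m ≠ 0) (ha : Summable fun i => a i ^ m) (hb : Summable fun i => b i ^ m) :
    ∃ i j, IsDescendingOrdering a b i j := by
  have h0 : ∀ p : ℕ × ℕ, 0 ≤ a p.1 * b p.2 := fun p => mul_nonneg (ha0 _) (hb0 _)
  obtain ⟨s, hs, hanti, hle⟩ := exists_descending_listing h0
    (tendsto_cofinite_zero_of_summable_pow h0 hm
      (hasSum_mul_pow ha0 hb0 ha.hasSum hb.hasSum).summable)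
  exact ⟨fun l => (s l).1, fun l => (s l).2, hs, hanti, fun p q h l => hle (p, q) h l⟩

/-- Unlisted products are `0`, so the listed power sum equals the sum over all pairs, which factors.
-/
theorem IsDescendingOrdering.hasSum_pow {i j : ℕ → ℕ} (h : IsDescendingOrdering a b i j)
    (ha0 : ∀ i, 0 ≤ a i) (hb0 : ∀ i, 0 ≤ b i) {m : ℕ} (hm : m ≠ 0) {x y : ℝ}
    (ha : HasSum (fun i => a i ^ m) x) (hb : HasSum (fun i => b i ^ m) y) :
    HasSum (fun l => (a (i l) * b (j l)) ^ m) (x * y) := by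
  have h0 : ∀ p : ℕ × ℕ, 0 ≤ a p.1 * b p.2 := fun p => mul_nonneg (ha0 _) (hb0 _)
  have hsum := hasSum_mul_pow ha0 hb0 ha hb
  have hzero : ∀ p ∉ Set.range fun l => (i l, j l), a p.1 * b p.2 = 0 := fun p hp =>
    eq_zero_of_notMem_listing h0 (tendsto_cofinite_zero_of_summable_pow h0 hm hsum.summable)
      h.injective (fun p hp l => h.le_of_notMem p.1 p.2 hp l) hp
  refine (h.injective.hasSum_iff fun p hp => ?_).mpr hsum
  rw [hzero p hp, zero_pow hm]

end Products

theorem spectrumFactorizes_of_tendsto {S T : Type*} {kS : S → S → ℝ} {kT : T → T → ℝ}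
    {z : ∀ n, Fin n → S × T} {lamS lamT : ℕ → ℝ} {i j : ℕ → ℕ}
    (hS : ∀ l, Tendsto (fun n : ℕ => (1 / n : ℝ) * matEigenvalue
      (kernelMatrix kS fun a => (z n a).1) l) atTop (𝓝 (lamS l)))
    (hT : ∀ l, Tendsto (fun n : ℕ => (1 / n : ℝ) * matEigenvalue
      (kernelMatrix kT fun a => (z n a).2) l) atTop (𝓝 (lamT l)))
    (hST : ∀ l, Tendsto (fun n : ℕ => (1 / n : ℝ) * matEigenvalue
      (kernelMatrix (separableKernel kS kT) (z n)) l) atTop (𝓝 (lamS (i l) * lamT (j l)))) :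
    SpectrumFactorizes kS kT z lamS lamT i j := by
  intro l lhs rhs
  have h1 : Tendsto (fun n : ℕ => (1 / n : ℝ) * lhs n) atTop (𝓝 (lamS (i l) * lamT (j l))) :=
    hST l
  have h2 : Tendsto (fun n : ℕ => (1 / n : ℝ) * rhs n) atTop (𝓝 (lamS (i l) * lamT (j l))) :=
    ((hS (i l)).mul (hT (j l))).congr fun n => by simp only [rhs]; ring
  refine ⟨h1, h2, ?_, fun hpos => ?_⟩
  · have := h1.sub h2
    rw [sub_self] at this
    exact this.congr fun n => by ring
  · have h3 := ((isEquivalent_const_iff_tendsto hpos.ne').mpr h1).trans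
      ((isEquivalent_const_iff_tendsto hpos.ne').mpr h2).symm
    have h4 := (IsEquivalent.refl (u := fun n : ℕ => (n : ℝ)) (l := atTop)).mul h3
    -- Both sides over `n` are equivalent to the same nonzero constant; multiplying by `n` removes
    -- the scaling for `n > 0`.
    have hcancel : ∀ f : ℕ → ℝ, ((fun n : ℕ => (n : ℝ)) * fun n : ℕ => (1 / n : ℝ) * f n)
        =ᶠ[atTop] f := by
      intro f
      filter_upwards [eventually_gt_atTop 0] with n hn
      have hn' : (n : ℝ) ≠ 0 := by exact_mod_cast hn.ne'
      simp only [Pi.mul_apply]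
      rw [← mul_assoc, mul_one_div_cancel hn', one_mul]
    exact (h4.congr_left (hcancel lhs)).congr_right (hcancel rhs)

/-- The averages over the points of `z n` of the closed walk weights of `K` converge to the traces
of the iterated kernels of `K` with respect to `ν`. -/
def ClosedWalksConverge {E : Type*} [MeasurableSpace E] (K : E → E → ℝ) (z : ∀ n, Fin n → E)
    (ν : Measure E) : Prop :=
  ∀ q : ℕ, Tendsto (fun n : ℕ => (1 / n : ℝ) ^ (q + 1) *
    ∑ c : Fin (q + 1) → Fin n, closedWalkWeight K q (z n ∘ c)) atTop (𝓝 (kernelTrace K ν q))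

/-- The spectrum factorizes if the averages of the closed walk weights converge for both kernels
and for their product. -/
theorem spectrumFactorizes_of_closedWalksConverge {S T : Type*} [MeasurableSpace S]
    [MeasurableSpace T] {kS : S → S → ℝ} {kT : T → T → ℝ} (hkS : IsCorrelation kS)
    (hkT : IsCorrelation kT) (μS : Measure S) (μT : Measure T) [IsProbabilityMeasure μS]
    [IsProbabilityMeasure μT] {z : ∀ n, Fin n → S × T} {i j : ℕ → ℕ}
    (hij : IsDescendingOrdering (opEigenvalue (covOperator hkS μS))
      (opEigenvalue (covOperator hkT μT)) i j)
    (hS : ClosedWalksConverge (fun p p' => kS p.1 p'.1) z (μS.prod μT))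
    (hT : ClosedWalksConverge (fun p p' => kT p.2 p'.2) z (μS.prod μT))
    (hST : ClosedWalksConverge (separableKernel kS kT) z (μS.prod μT)) :
    SpectrumFactorizes kS kT z (opEigenvalue (covOperator hkS μS))
      (opEigenvalue (covOperator hkT μT)) i j := by
  obtain ⟨hS1, hS2, hS3⟩ := opEigenvalue_covOperator hkS μS
  obtain ⟨hT1, hT2, hT3⟩ := opEigenvalue_covOperator hkT μT
  refine spectrumFactorizes_of_tendsto ?_ ?_ ?_
  · refine tendsto_matEigenvalue (k := fun p p' : S × T => kS p.1 p'.1) (z := z)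
      (posSemidef_kernelMatrix_comp hkS Prod.fst) (fun p => hkS.diag p.1) hS2 hS1
      (L := kernelTrace (fun p p' : S × T => kS p.1 p'.1) (μS.prod μT)) (fun q => ?_) hS
    -- The pulled-back kernel sees only the first marginal, which is `μS`.
    rw [kernelTrace_comp measurable_fst hkS.measurable, Measure.map_fst_prod, measure_univ,
      one_smul]
    exact hS3 q
  · refine tendsto_matEigenvalue (k := fun p p' : S × T => kT p.2 p'.2) (z := z)
      (posSemidef_kernelMatrix_comp hkT Prod.snd) (fun p => hkT.diag p.2) hT2 hT1
      (L := kernelTrace (fun p p' : S × T => kT p.2 p'.2) (μS.prod μT)) (fun q => ?_) hT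
    rw [kernelTrace_comp measurable_snd hkT.measurable, Measure.map_snd_prod, measure_univ,
      one_smul]
    exact hT3 q
  · refine tendsto_matEigenvalue (k := separableKernel kS kT) (z := z)
      (posSemidef_kernelMatrix_separable hkS hkT)
      (fun p => by rw [separableKernel, hkS.diag, hkT.diag, one_mul])
      (lam := fun l => opEigenvalue (covOperator hkS μS) (i l) *
        opEigenvalue (covOperator hkT μT) (j l))
      (fun l => mul_nonneg (hS2 _) (hT2 _)) hij.antitone
      (L := kernelTrace (separableKernel kS kT) (μS.prod μT)) (fun q => ?_) hST
    rw [kernelTrace_separableKernel]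
    exact hij.hasSum_pow hS2 hT2 (by omega) (hS3 q) (hT3 q)

theorem ae_closedWalksConverge {E Ω : Type*} [MeasurableSpace E] [MeasurableSpace Ω]
    {P : Measure Ω} [IsProbabilityMeasure P] {ν : Measure E} [IsProbabilityMeasure ν]
    {Z : ℕ → Ω → E} (hZ : ∀ m, Measurable (Z m)) (hind : iIndepFun Z P)
    (hlaw : ∀ m, P.map (Z m) = ν) {K : E → E → ℝ} (hK : Measurable (Function.uncurry K))
    (hK1 : ∀ x y, |K x y| ≤ 1) :
    ∀ᵐ ω ∂P, ClosedWalksConverge K (fun _ a => Z a ω) ν := by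
  unfold ClosedWalksConverge
  rw [ae_all_iff]
  intro q
  have h := ae_tendsto_vStatistic hZ hind hlaw (measurable_closedWalkWeight hK q)
    fun e => abs_walkWeight_le_one hK1 q (e 0) (e 0) (Fin.tail e)
  rw [integral_closedWalkWeight hK hK1, Fintype.card_fin] at h
  exact h

theorem mainTheorem8 (d : ℕ) (T : Set ℝ)
    (kS : SpatialDomain d → SpatialDomain d → ℝ) (kT : T → T → ℝ)
    (hkS : IsCorrelation kS) (hkT : IsCorrelation kT)
    (hstatS : IsStationaryKernel (fun (x : SpatialDomain d) (a : Fin d) => (x a : ℝ)) kS)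
    (hstatT : IsStationaryKernel (fun t : T => (t : ℝ)) kT)
    (μS : Measure (SpatialDomain d)) [IsProbabilityMeasure μS]
    (μT : Measure T) [IsProbabilityMeasure μT] :
    -- the index sequences of the descending ordering exist
    (∃ i j : ℕ → ℕ, IsDescendingOrdering (opEigenvalue (covOperator hkS μS))
      (opEigenvalue (covOperator hkT μT)) i j) ∧
    ∀ i j : ℕ → ℕ,
      IsDescendingOrdering (opEigenvalue (covOperator hkS μS))
        (opEigenvalue (covOperator hkT μT)) i j →
      -- observation points drawn independently from `μS ⊗ μT`
      (∀ {Ω : Type*} [MeasurableSpace Ω] (P : Measure Ω) [IsProbabilityMeasure P]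
        (Z : ℕ → Ω → SpatialDomain d × T),
        (∀ m, Measurable (Z m)) → iIndepFun Z P → (∀ m, P.map (Z m) = μS.prod μT) →
        ∀ᵐ ω ∂P, SpectrumFactorizes kS kT (fun _ a => Z a ω)
          (opEigenvalue (covOperator hkS μS))
          (opEigenvalue (covOperator hkT μT)) i j) ∧
      -- continuous kernels, arbitrary (for instance deterministic) observation points with
      -- limit distribution `μS ⊗ μT`
      (Continuous (Function.uncurry kS) → Continuous (Function.uncurry kT) →
        ∀ z : ∀ n, Fin n → SpatialDomain d × T,
          HasLimitDistribution kS kT z (μS.prod μT) →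
          SpectrumFactorizes kS kT z (opEigenvalue (covOperator hkS μS))
            (opEigenvalue (covOperator hkT μT)) i j) := by
  obtain ⟨-, hS2, hS3⟩ := opEigenvalue_covOperator hkS μS
  obtain ⟨-, hT2, hT3⟩ := opEigenvalue_covOperator hkT μT
  refine ⟨exists_isDescendingOrdering hS2 hT2 (by norm_num) (hS3 0).summable (hT3 0).summable,
    fun i j hij => ⟨fun P _ Z hZ hind hlaw => ?_, fun hcS hcT z hz => ?_⟩⟩
  · filter_upwards [ae_closedWalksConverge hZ hind hlaw
        (K := fun p p' => kS p.1 p'.1)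
        (hkS.measurable.comp (measurable_fst.fst.prodMk measurable_snd.fst))
        fun p p' => hkS.abs_le_one p.1 p'.1,
      ae_closedWalksConverge hZ hind hlaw (K := fun p p' => kT p.2 p'.2)
        (hkT.measurable.comp (measurable_fst.snd.prodMk measurable_snd.snd))
        fun p p' => hkT.abs_le_one p.2 p'.2,
      ae_closedWalksConverge hZ hind hlaw
        (measurable_separableKernel hkS.measurable hkT.measurable)
        (abs_separableKernel_le_one hkS.abs_le_one hkT.abs_le_one)] with ω h1 h2 h3
    exact spectrumFactorizes_of_closedWalksConverge hkS hkT μS μT hij h1 h2 h3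
  · have hKS := continuous_kernelOnSpace hkS hcS
    have hKT := continuous_kernelOnSpace hkT hcT
    refine spectrumFactorizes_of_closedWalksConverge hkS hkT μS μT hij ?_ ?_ ?_
    · exact hz.tendsto_closedWalkWeight hkS hkT hcS hcT
        (K := fun p p' => kernelOnSpace hkS hcS p.1 p'.1)
        (hKS.comp (continuous_fst.fst.prodMk continuous_snd.fst))
        fun p p' => hkS.abs_le_one _ _
    · exact hz.tendsto_closedWalkWeight hkS hkT hcS hcT
        (K := fun p p' => kernelOnSpace hkT hcT p.2 p'.2)
        (hKT.comp (continuous_fst.snd.prodMk continuous_snd.snd))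
        fun p p' => hkT.abs_le_one _ _
    · exact hz.tendsto_closedWalkWeight hkS hkT hcS hcT
        (K := separableKernel (kernelOnSpace hkS hcS) (kernelOnSpace hkT hcT))
        ((hKS.comp (continuous_fst.fst.prodMk continuous_snd.fst)).mul
          (hKT.comp (continuous_fst.snd.prodMk continuous_snd.snd)))
        (abs_separableKernel_le_one (fun x y => hkS.abs_le_one _ _)
          fun x y => hkT.abs_le_one _ _)
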